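/- Let $\delta\in\mathbb{C}$. An affine diagram with $3$ marked points is a homotopy class (relative to the boundary) of pictures on the lateral surface of a vertical cylinder with marked points $1,2,3$ on the top boundary circle and $1,2,3$ on the bottom boundary circle, in which the six marked points are joined pairwise by non-intersecting arcs. For two such diagrams $\alpha,\beta$, glue the bottom circle of $\alpha$ to the top circle of $\beta$ so that equally numbered marked points coincide; let $m(\alpha,\beta)$ be the number of closed loops that arise and $\alpha\circ\beta$ the affine diagram that remains after removing them. Let $T_3(\delta)$ be the associative unital $\mathbb{C}$-algebra whose underlying vector space has the affine diagrams with $3$ marked points as a basis and whose product is determined by $\alpha\beta=\delta^{m(\alpha,\beta)}\,\alpha\circ\beta$. Then the center of $T_3(\delta)$ is isomorphic, as a $\mathbb{C}$-algebra, to the subalgebra $$\left\{(S,T)\in\mathbb{C}[x,x^{-1}]\times\mathbb{C}[x,x^{-1}] \;:\; x^2+x^{-2}+\delta \ \text{ divides } \ S(x)-T(x^3) \ \text{ in } \ \mathbb{C}[x,x^{-1}]\right\}$$ of $\mathbb{C}[x,x^{-1}]\times\mathbb{C}[x,x^{-1}]$ with componentwise operations. -/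

import Mathlib

namespace AffineTL

set_option linter.unusedSectionVars false

open Relation

/-! ### Orbits of two involutions (used to see that gluing two diagrams gives a diagram) -/

open Equiv in
theorem dihedral_period {X : Type*} (a b s : Equiv.Perm X) (ha : a * a = 1) (hb : b * b = 1)
    (hsa : Commute s a) (hsb : Commute s b) (x : X) (hbx : b x = x)
    (hfin : ∃ m n : ℤ, m ≠ n ∧ ∃ k : ℤ, ((a * b) ^ m) x = (s ^ k) (((a * b) ^ n) x)) :
    ∃ d : ℕ, 0 < d ∧ ((a * b) ^ d) x = x := by
  have ha' : a⁻¹ = a := inv_eq_of_mul_eq_one_left ha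
  have hb' : b⁻¹ = b := inv_eq_of_mul_eq_one_left hb
  have hst : Commute s (a * b) := hsa.mul_right hsb
  have hconj : ∀ n : ℤ, b * (a * b) ^ n = (a * b) ^ (-n) * b := by
    intro n
    have h1 : b * (a * b) * b⁻¹ = (a * b)⁻¹ := by
      rw [mul_inv_rev, ha', hb']; simp [mul_assoc, hb]
    have h2 : b * (a * b) ^ n * b⁻¹ = (a * b) ^ (-n) := by
      rw [← conj_zpow, h1, inv_zpow, zpow_neg]
    rw [← h2]; simp
  obtain ⟨m, n, hmn, k, hk⟩ := hfin
  have h1 : ((a * b) ^ (m - n)) x = (s ^ k) x := by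
    have hc : Commute ((a * b) ^ (-n)) (s ^ k) := (hst.zpow_zpow k (-n)).symm
    have : ((a * b) ^ (-n)) (((a * b) ^ m) x) = ((a * b) ^ (-n)) ((s ^ k) (((a * b) ^ n) x)) := by
      rw [hk]
    rw [← Perm.mul_apply, ← zpow_add, ← Perm.mul_apply, hc.eq, Perm.mul_apply,
      ← Perm.mul_apply _ ((a * b) ^ n), ← zpow_add] at this
    simpa [add_comm, sub_eq_add_neg] using this
  have h2 : ((a * b) ^ (-(m - n))) x = (s ^ k) x := by
    have e1 : (b * (a * b) ^ (m - n)) x = (b * s ^ k) x := by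
      rw [Perm.mul_apply, h1, Perm.mul_apply]
    rw [hconj, ((hsb.zpow_left k).symm).eq, Perm.mul_apply, Perm.mul_apply, hbx] at e1
    exact e1
  have h3 : ((a * b) ^ (2 * (m - n))) x = x := by
    rw [two_mul, zpow_add, Perm.mul_apply, h1, ← h2, ← Perm.mul_apply, ← zpow_add]
    simp
  refine ⟨(2 * (m - n)).natAbs, by omega, ?_⟩
  rcases Int.natAbs_eq (2 * (m - n)) with h | h
  · rw [h, zpow_natCast] at h3; exact h3
  · rw [h, zpow_neg, zpow_natCast, Perm.inv_eq_iff_eq] at h3; exact h3.symm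

open Equiv in
theorem dihedral_unique {X : Type*} (a b : Equiv.Perm X) (ha : a * a = 1) (hb : b * b = 1)
    (x : X) (hbx : b x = x) (hax : a x ≠ x) (hper : ∃ d : ℕ, 0 < d ∧ ((a * b) ^ d) x = x) :
    ∃! y, y ≠ x ∧ (∃ n : ℤ, y = ((a * b) ^ n) x) ∧ (a y = y ∨ b y = y) := by
  have ha' : a⁻¹ = a := inv_eq_of_mul_eq_one_left ha
  have hb' : b⁻¹ = b := inv_eq_of_mul_eq_one_left hb
  have hconj : ∀ n : ℤ, b * (a * b) ^ n = (a * b) ^ (-n) * b := by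
    intro n
    have h1 : b * (a * b) * b⁻¹ = (a * b)⁻¹ := by
      rw [mul_inv_rev, ha', hb']; simp [mul_assoc, hb]
    have h2 : b * (a * b) ^ n * b⁻¹ = (a * b) ^ (-n) := by
      rw [← conj_zpow, h1, inv_zpow, zpow_neg]
    rw [← h2]; simp
  have hbn : ∀ n : ℤ, b (((a * b) ^ n) x) = ((a * b) ^ (-n)) x := by
    intro n
    rw [← Perm.mul_apply, hconj, Perm.mul_apply, hbx]
  have han : ∀ n : ℤ, a (((a * b) ^ n) x) = ((a * b) ^ (1 - n)) x := by
    intro n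
    have : ∀ z, a z = (a * b) (b z) := fun z => by
      rw [← Perm.mul_apply, mul_assoc, hb, mul_one]
    rw [this, hbn, ← Perm.mul_apply, ← zpow_one_add, sub_eq_add_neg]
  obtain ⟨p, hp0, hp⟩ : ∃ p : ℕ, 0 < p ∧ ∀ n : ℤ, ((a * b) ^ n) x = x ↔ (p : ℤ) ∣ n := by
    obtain ⟨d, hd, hdx⟩ := hper
    refine ⟨Function.minimalPeriod (a * b) x, ?_, ?_⟩
    · apply Function.IsPeriodicPt.minimalPeriod_pos hd
      rw [Function.IsPeriodicPt, Function.IsFixedPt, Perm.iterate_eq_pow]; exact hdx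
    · intro n
      exact MulAction.zpow_smul_eq_iff_minimalPeriod_dvd (a := a * b) (b := x)
  have heq : ∀ m n : ℤ, ((a * b) ^ m) x = ((a * b) ^ n) x ↔ (p : ℤ) ∣ m - n := by
    intro m n
    rw [← hp, sub_eq_neg_add, zpow_add, Perm.mul_apply, zpow_neg, Perm.inv_eq_iff_eq]
  have hp1 : p ≠ 1 := by
    rintro rfl
    have := (hp 1).2 (by simp)
    rw [zpow_one, Perm.mul_apply, hbx] at this
    exact hax this
  rcases Nat.even_or_odd' p with ⟨l, rfl | rfl⟩
  · refine ⟨((a * b) ^ (l : ℤ)) x, ⟨?_, ⟨_, rfl⟩, ?_⟩, ?_⟩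
    · rw [Ne, hp]; intro h
      have := Int.le_of_dvd (by omega) h
      push_cast at this; omega
    · right; rw [hbn, heq]; exact ⟨-1, by push_cast; ring⟩
    · rintro _ ⟨h1, ⟨n, rfl⟩, h2⟩
      rw [Ne, hp] at h1
      rw [han, hbn, heq, heq] at h2
      rw [heq]
      push_cast at *
      rcases h2 with ⟨c, hc⟩ | ⟨c, hc⟩
      · exfalso; have : 2 * (l * c) = 1 - n - n := by rw [← mul_assoc]; exact hc.symm
        omega
      · have hn : n = - (l * c) := by
          have : 2 * (l * c) = - n - n := by rw [← mul_assoc]; exact hc.symm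
          omega
        rcases Int.even_or_odd' c with ⟨e, rfl | rfl⟩
        · exact absurd ⟨-e, by rw [hn]; ring⟩ h1
        · exact ⟨-e - 1, by rw [hn]; ring⟩
  · refine ⟨((a * b) ^ (l + 1 : ℤ)) x, ⟨?_, ⟨_, rfl⟩, ?_⟩, ?_⟩
    · rw [Ne, hp]; intro h
      have := Int.le_of_dvd (by omega) h
      push_cast at this; omega
    · left; rw [han, heq]; exact ⟨-1, by push_cast; ring⟩
    · rintro _ ⟨h1, ⟨n, rfl⟩, h2⟩
      rw [Ne, hp] at h1
      rw [han, hbn, heq, heq] at h2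
      rw [heq]
      have hcop : IsCoprime ((2 * l + 1 : ℕ) : ℤ) 2 := ⟨1, -l, by push_cast; ring⟩
      rcases h2 with h2 | h2
      · apply hcop.dvd_of_dvd_mul_left
        have := dvd_add h2 (dvd_refl ((2 * l + 1 : ℕ) : ℤ))
        rw [← dvd_neg]
        convert this using 1; push_cast; ring
      · exfalso; apply h1
        apply hcop.dvd_of_dvd_mul_left
        have e : (2 : ℤ) * n = -(-n - n) := by ring
        rw [e, dvd_neg]
        exact h2

/-! ### Affine diagrams

The cylinder is unrolled to an infinite strip. A point `Sum.inl i` (resp. `Sum.inr i`) is a lift of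
the marked point `i mod N` of the top (resp. bottom) circle, `Sum.inl i` lying over `Sum.inr i`. -/

/-- The deck transformation of the strip: one full turn around the cylinder. -/
def shift (N : ℕ) (x : ℤ ⊕ ℤ) : ℤ ⊕ ℤ := Sum.map (· + (N : ℤ)) (· + (N : ℤ)) x

/-- The order in which the boundary points of the strip are met when one travels along the top line
from left to right and then along the bottom line from right to left. -/
def Before : ℤ ⊕ ℤ → ℤ ⊕ ℤ → Prop
  | .inl i, .inl j => i < j
  | .inl _, .inr _ => True
  | .inr _, .inl _ => False
  | .inr i, .inr j => j < i

/-- A (homotopy class of an) affine diagram with `N` marked points on each boundary circle of the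
cylinder. Arcs on the cylinder are recorded by the end points of all their lifts to the strip.
* `arcs x y` says that `x = y` or that `x` and `y` are the two ends of a lifted arc;
* every marked point is joined to exactly one other marked point;
* the picture is invariant under the deck transformation;
* no two arcs intersect;
* `circles` is the number of circles going around the cylinder, which is possible only if no arc
  joins the top to the bottom. -/
@[ext]
structure AffineDiagram (N : ℕ) [NeZero N] where
  arcs : Setoid (ℤ ⊕ ℤ)
  existsUnique_partner : ∀ x, ∃! y, y ≠ x ∧ arcs x y
  periodic : ∀ x y, arcs (shift N x) (shift N y) ↔ arcs x y
  noncrossing : ∀ a b c d, Before a b → Before b c → Before c d → arcs a c → ¬ arcs b d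
  circles : ℕ
  circles_eq_zero : ∀ i j : ℤ, arcs (Sum.inl i) (Sum.inr j) → circles = 0

/-- Several cylinders stacked on each other: `(r, i)` is the point `i` of the horizontal line number
`r`. The map `place r s` puts the top line of a diagram on the line `r`, the bottom one on `s`. -/
def place (r s : ℕ) : ℤ ⊕ ℤ → ℕ × ℤ
  | .inl i => (r, i)
  | .inr i => (s, i)

/-- The closed curves on the cylinder that arise by gluing and only meet the line `r`; each one is
recorded by the set of all lifts of the marked points on it. Here `E` is the relation "connected in
the strip". The curve through `(r, i)` is essential (it goes around the cylinder) if its lift is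
invariant under some nontrivial deck transformation, i.e. joins `(r, i)` to `(r, i + k * N)` with
`k ≠ 0`; otherwise it is a contractible loop. -/
def components (N : ℕ) (E : Setoid (ℕ × ℤ)) (r : ℕ) (essential : Prop) : Set (Set ℤ) :=
  {C | ∃ i : ℤ, (∀ p, E (r, i) p → p.1 = r) ∧
    ((∃ k : ℤ, k ≠ 0 ∧ E (r, i) (r, i + k * N)) ↔ essential) ∧
    C = {j | ∃ k : ℤ, E (r, i) (r, j + k * N)}}

namespace AffineDiagram

variable {N : ℕ} [NeZero N]

/-- The arcs of `α` drawn between the lines `r` and `s`. -/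
def onRows (α : AffineDiagram N) (r s : ℕ) : Setoid (ℕ × ℤ) := α.arcs.map (place r s)

/-- `α` (between the lines `0` and `1`) glued on top of `β` (between the lines `1` and `2`): two
points are related if a chain of arcs of `α` and `β` connects them. -/
def glue (α β : AffineDiagram N) : Setoid (ℕ × ℤ) := α.onRows 0 1 ⊔ β.onRows 1 2

/-- The number `m(α, β)` of contractible loops that appear when `α` is glued to `β`. -/
noncomputable def loops (α β : AffineDiagram N) : ℕ :=
  (components N (glue α β) 1 False).ncard

/-- The number of circles around the cylinder formed by arcs when `α` is glued to `β`. -/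
noncomputable def newCircles (α β : AffineDiagram N) : ℕ :=
  (components N (glue α β) 1 True).ncard

/-! ### Components of the glued picture -/

theorem onRows_le {α : AffineDiagram N} {r s : ℕ} {S : Setoid (ℕ × ℤ)}
    (h : ∀ x y, α.arcs x y → S (place r s x) (place r s y)) : α.onRows r s ≤ S := by
  apply Setoid.eqvGen_le
  rintro _ _ ⟨x, y, hxy, rfl, rfl⟩
  exact h x y hxy

theorem onRows_of_arcs {α : AffineDiagram N} {r s : ℕ} {x y} (h : α.arcs x y) :
    α.onRows r s (place r s x) (place r s y) :=
  EqvGen.rel _ _ ⟨x, y, h, rfl, rfl⟩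

/-- The other end of the arc at `x`. -/
noncomputable def partner (α : AffineDiagram N) (x : ℤ ⊕ ℤ) : ℤ ⊕ ℤ :=
  (α.existsUnique_partner x).choose

theorem partner_ne (α : AffineDiagram N) (x) : α.partner x ≠ x :=
  (α.existsUnique_partner x).choose_spec.1.1

theorem arcs_partner (α : AffineDiagram N) (x) : α.arcs x (α.partner x) :=
  (α.existsUnique_partner x).choose_spec.1.2

theorem eq_partner (α : AffineDiagram N) {x y} (h : y ≠ x) (h' : α.arcs x y) : y = α.partner x :=
  (α.existsUnique_partner x).choose_spec.2 y ⟨h, h'⟩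

theorem arcs_iff (α : AffineDiagram N) {x y} : α.arcs x y ↔ y = x ∨ y = α.partner x := by
  constructor
  · intro h
    by_cases hxy : y = x
    · exact Or.inl hxy
    · exact Or.inr (α.eq_partner hxy h)
  · rintro (rfl | rfl)
    · exact α.arcs.refl' _
    · exact α.arcs_partner _

theorem partner_partner (α : AffineDiagram N) (x) : α.partner (α.partner x) = x :=
  (α.eq_partner (α.partner_ne x).symm (α.arcs.symm' (α.arcs_partner x))).symm

theorem shift_injective : Function.Injective (shift N) := by
  rintro (i | i) (j | j) h <;> simp [shift] at h ⊢ <;> exact h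

theorem partner_shift (α : AffineDiagram N) (x) :
    α.partner (shift N x) = shift N (α.partner x) := by
  refine (α.eq_partner ?_ ?_).symm
  · exact fun h => α.partner_ne x (shift_injective h)
  · exact (α.periodic _ _).2 (α.arcs_partner x)

/-- The involution of the stacked lines that swaps the ends of each arc. -/
noncomputable def rowFun (α : AffineDiagram N) (r s : ℕ) (p : ℕ × ℤ) : ℕ × ℤ :=
  if p.1 = r then place r s (α.partner (Sum.inl p.2))
  else if p.1 = s then place r s (α.partner (Sum.inr p.2)) else p

theorem rowFun_place (α : AffineDiagram N) {r s : ℕ} (h : r ≠ s) (x) :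
    α.rowFun r s (place r s x) = place r s (α.partner x) := by
  rcases x with i | i
  · simp [rowFun, place]
  · simp [rowFun, place, h.symm]

theorem rowFun_of_ne (α : AffineDiagram N) {r s : ℕ} {p : ℕ × ℤ} (h : p.1 ≠ r) (h' : p.1 ≠ s) :
    α.rowFun r s p = p := by simp [rowFun, h, h']

theorem place_injective {r s : ℕ} (h : r ≠ s) : Function.Injective (place r s) := by
  rintro (i | i) (j | j) e <;> simp [place] at e
  · rw [e]
  · exact absurd e.1 h
  · exact absurd e.1 h.symm
  · rw [e]

theorem place_cases (r s : ℕ) (p : ℕ × ℤ) :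
    (∃ x, p = place r s x) ∨ (p.1 ≠ r ∧ p.1 ≠ s) := by
  obtain ⟨t, i⟩ := p
  by_cases h : t = r
  · exact Or.inl ⟨Sum.inl i, by simp [place, h]⟩
  · by_cases h' : t = s
    · exact Or.inl ⟨Sum.inr i, by simp [place, h']⟩
    · exact Or.inr ⟨h, h'⟩

theorem rowFun_rowFun (α : AffineDiagram N) {r s : ℕ} (h : r ≠ s) (p) :
    α.rowFun r s (α.rowFun r s p) = p := by
  rcases place_cases r s p with ⟨x, rfl⟩ | ⟨h1, h2⟩
  · rw [rowFun_place α h, rowFun_place α h, partner_partner]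
  · rw [rowFun_of_ne α h1 h2, rowFun_of_ne α h1 h2]

theorem rowFun_fixed (α : AffineDiagram N) {r s : ℕ} (h : r ≠ s) {p} :
    α.rowFun r s p = p ↔ p.1 ≠ r ∧ p.1 ≠ s := by
  rcases place_cases r s p with ⟨x, rfl⟩ | ⟨h1, h2⟩
  · rw [rowFun_place α h, (place_injective h).eq_iff]
    refine iff_of_false (α.partner_ne x) ?_
    rcases x with i | i <;> simp [place]
  · rw [rowFun_of_ne α h1 h2]; simp [h1, h2]

theorem onRows_rowFun (α : AffineDiagram N) {r s : ℕ} (h : r ≠ s) (p) :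
    α.onRows r s p (α.rowFun r s p) := by
  rcases place_cases r s p with ⟨x, rfl⟩ | ⟨h1, h2⟩
  · rw [rowFun_place α h]; exact onRows_of_arcs (α.arcs_partner x)
  · rw [rowFun_of_ne α h1 h2]

/-- The deck transformation on stacked lines. -/
def rowShift (N : ℕ) : Equiv.Perm (ℕ × ℤ) := (Equiv.refl ℕ).prodCongr (Equiv.addRight (N : ℤ))

theorem rowShift_apply (p : ℕ × ℤ) : rowShift N p = (p.1, p.2 + N) := rfl

theorem rowShift_zpow (k : ℤ) (p : ℕ × ℤ) : (rowShift N ^ k) p = (p.1, p.2 + k * N) := by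
  induction k using Int.induction_on generalizing p with
  | zero => simp
  | succ n ih =>
    rw [zpow_add_one, Equiv.Perm.mul_apply, ih, rowShift_apply]
    ext
    · rfl
    · push_cast; ring
  | pred n ih =>
    have : (rowShift N)⁻¹ p = (p.1, p.2 - N) := by
      rw [Equiv.Perm.inv_eq_iff_eq, rowShift_apply]; simp
    rw [zpow_sub_one, Equiv.Perm.mul_apply, this, ih]
    ext
    · rfl
    · push_cast; ring

theorem place_shift (r s : ℕ) (x) : place r s (shift N x) = rowShift N (place r s x) := by
  rcases x with i | i <;> rfl

/-- `rowFun` as a permutation. -/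
noncomputable def rowPerm (α : AffineDiagram N) (r s : ℕ) (h : r ≠ s) : Equiv.Perm (ℕ × ℤ) :=
  Function.Involutive.toPerm (α.rowFun r s) (α.rowFun_rowFun h)

theorem rowPerm_apply (α : AffineDiagram N) {r s : ℕ} (h : r ≠ s) (p) :
    α.rowPerm r s h p = α.rowFun r s p := rfl

theorem rowPerm_sq (α : AffineDiagram N) {r s : ℕ} (h : r ≠ s) :
    α.rowPerm r s h * α.rowPerm r s h = 1 := by
  ext1 p; exact α.rowFun_rowFun h p

theorem commute_rowPerm (α : AffineDiagram N) {r s : ℕ} (h : r ≠ s) :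
    Commute (rowShift N) (α.rowPerm r s h) := by
  ext1 p
  rw [Equiv.Perm.mul_apply, Equiv.Perm.mul_apply, rowPerm_apply, rowPerm_apply]
  rcases place_cases r s p with ⟨x, rfl⟩ | ⟨h1, h2⟩
  · rw [← place_shift, rowFun_place α h, rowFun_place α h, partner_shift, place_shift]
  · rw [rowFun_of_ne α h1 h2, rowFun_of_ne α (by simpa [rowShift_apply] using h1)
      (by simpa [rowShift_apply] using h2)]

/-- Invariance of a relation under deck transformations. -/
def Periodic (N : ℕ) (E : Setoid (ℕ × ℤ)) : Prop :=
  ∀ (k : ℤ) p q, E p q → E (p.1, p.2 + k * N) (q.1, q.2 + k * N)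

theorem periodic_onRows (α : AffineDiagram N) (r s : ℕ) : Periodic N (α.onRows r s) := by
  have key : ∀ k : ℤ, α.onRows r s ≤ (α.onRows r s).comap (rowShift N ^ k) := by
    have h1 : α.onRows r s ≤ (α.onRows r s).comap (rowShift N) :=
      onRows_le fun x y hxy => by
        rw [Setoid.comap_rel, ← place_shift, ← place_shift]
        exact onRows_of_arcs ((α.periodic _ _).2 hxy)
    have h2 : α.onRows r s ≤ (α.onRows r s).comap ((rowShift N)⁻¹ : Equiv.Perm (ℕ × ℤ)) :=
      onRows_le fun x y hxy => by
        rw [Setoid.comap_rel]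
        have hs : ∀ x : ℤ ⊕ ℤ, ∃ x', shift N x' = x := by
          rintro (i | i)
          · exact ⟨Sum.inl (i - N), by simp [shift]⟩
          · exact ⟨Sum.inr (i - N), by simp [shift]⟩
        obtain ⟨x, rfl⟩ := hs x
        obtain ⟨y, rfl⟩ := hs y
        rw [place_shift, place_shift, Equiv.Perm.inv_def, Equiv.symm_apply_apply,
          Equiv.symm_apply_apply]
        exact onRows_of_arcs ((α.periodic _ _).1 hxy)
    intro k
    induction k using Int.induction_on with
    | zero => intro p q h; simpa [Setoid.comap_rel] using h
    | succ n ih =>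
      intro p q h
      rw [Setoid.comap_rel, zpow_add_one, Equiv.Perm.mul_apply, Equiv.Perm.mul_apply]
      exact ih (h1 h)
    | pred n ih =>
      intro p q h
      rw [Setoid.comap_rel, zpow_sub_one, Equiv.Perm.mul_apply, Equiv.Perm.mul_apply]
      exact ih (h2 h)
  intro k p q h
  have := key k h
  rwa [Setoid.comap_rel, rowShift_zpow, rowShift_zpow] at this

theorem Periodic.sup {E F : Setoid (ℕ × ℤ)} (hE : Periodic N E) (hF : Periodic N F) :
    Periodic N (E ⊔ F) := by
  intro k p q h
  have : E ⊔ F ≤ (E ⊔ F).comap (fun p => (p.1, p.2 + k * N)) :=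
    sup_le (fun p q h => (le_sup_left : E ≤ E ⊔ F) (hE k p q h))
      (fun p q h => (le_sup_right : F ≤ E ⊔ F) (hF k p q h))
  exact this h

theorem periodic_glue (α β : AffineDiagram N) : Periodic N (glue α β) :=
  (α.periodic_onRows 0 1).sup (β.periodic_onRows 1 2)

/-! ### components are orbits -/

theorem glue_of_left {α β : AffineDiagram N} {p q} (h : α.onRows 0 1 p q) : glue α β p q :=
  (le_sup_left : α.onRows 0 1 ≤ glue α β) h

theorem glue_of_right {α β : AffineDiagram N} {p q} (h : β.onRows 1 2 p q) : glue α β p q :=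
  (le_sup_right : β.onRows 1 2 ≤ glue α β) h

theorem glue_le {α β : AffineDiagram N} {S : Setoid (ℕ × ℤ)}
    (h : ∀ x y, α.arcs x y → S (place 0 1 x) (place 0 1 y))
    (h' : ∀ x y, β.arcs x y → S (place 1 2 x) (place 1 2 y)) : glue α β ≤ S :=
  sup_le (onRows_le h) (onRows_le h')

theorem glue_closed {α β : AffineDiagram N} (O : Set (ℕ × ℤ))
    (h : ∀ p ∈ O, α.rowFun 0 1 p ∈ O) (h' : ∀ p ∈ O, β.rowFun 1 2 p ∈ O) {p q}
    (hpq : glue α β p q) (hp : p ∈ O) : q ∈ O := by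
  have key : glue α β ≤ Setoid.ker (fun p => p ∈ O) := by
    have h1 : ∀ p, α.rowFun 0 1 p ∈ O ↔ p ∈ O := fun p =>
      ⟨fun hh => by simpa [rowFun_rowFun] using h _ hh, h p⟩
    have h2 : ∀ p, β.rowFun 1 2 p ∈ O ↔ p ∈ O := fun p =>
      ⟨fun hh => by simpa [rowFun_rowFun] using h' _ hh, h' p⟩
    refine glue_le ?_ ?_
    · intro x y hxy
      rcases α.arcs_iff.1 hxy with rfl | rfl
      · exact Setoid.refl' _ _
      · rw [Setoid.ker_def, ← rowFun_place α (by norm_num), h1]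
    · intro x y hxy
      rcases β.arcs_iff.1 hxy with rfl | rfl
      · exact Setoid.refl' _ _
      · rw [Setoid.ker_def, ← rowFun_place β (by norm_num), h2]
  have := key hpq
  rw [Setoid.ker_def] at this
  rwa [← this]

theorem glue_row {α β : AffineDiagram N} {p q} (hpq : glue α β p q) (hp : p.1 ≤ 2) : q.1 ≤ 2 := by
  have hpl : ∀ r s : ℕ, r ≤ 2 → s ≤ 2 → ∀ x, (place r s x).1 ≤ 2 := by
    intro r s hr hs x; rcases x with i | i <;> simpa [place]
  refine glue_closed (O := {p | p.1 ≤ 2}) ?_ ?_ hpq hp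
  · intro p hp
    rcases place_cases 0 1 p with ⟨x, rfl⟩ | ⟨h1, h2⟩
    · rw [rowFun_place α (by norm_num)]; exact hpl _ _ (by norm_num) (by norm_num) _
    · rwa [rowFun_of_ne α h1 h2]
  · intro p hp
    rcases place_cases 1 2 p with ⟨x, rfl⟩ | ⟨h1, h2⟩
    · rw [rowFun_place β (by norm_num)]; exact hpl _ _ (by norm_num) (by norm_num) _
    · rwa [rowFun_of_ne β h1 h2]

theorem orbit_aux (α β : AffineDiagram N) (a b : Equiv.Perm (ℕ × ℤ))
    (ha : a * a = 1) (hb : b * b = 1) (hsa : Commute (rowShift N) a) (hsb : Commute (rowShift N) b)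
    (hga : ∀ p, glue α β p (a p)) (hgb : ∀ p, glue α β p (b p))
    (hcl : ∀ O : Set (ℕ × ℤ), (∀ p ∈ O, a p ∈ O) → (∀ p ∈ O, b p ∈ O) →
      ∀ p q, glue α β p q → p ∈ O → q ∈ O)
    (x : ℕ × ℤ) (hx2 : x.1 ≤ 2) (hbx : b x = x) (hax : a x ≠ x) :
    {y | glue α β x y}.Finite ∧ ∃! y, y ≠ x ∧ glue α β x y ∧ (a y = y ∨ b y = y) := by
  have hpow : ∀ n : ℤ, glue α β x (((a * b) ^ n) x) := by
    have h1 : ∀ p, glue α β p ((a * b) p) := fun p =>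
      Setoid.trans' _ (hgb p) (hga (b p))
    intro n
    induction n using Int.induction_on with
    | zero => exact Setoid.refl' _ _
    | succ n ih =>
      rw [zpow_add_one, (Commute.refl (a * b)).zpow_left _ |>.eq]
      exact Setoid.trans' _ ih (h1 _)
    | pred n ih =>
      rw [zpow_sub_one, ((Commute.refl (a * b)).zpow_left _).inv_right.eq]
      refine Setoid.trans' _ ih (Setoid.symm' _ ?_)
      have := h1 ((a * b)⁻¹ (((a * b) ^ (-(n : ℤ))) x))
      rwa [Equiv.Perm.inv_def (a * b), Equiv.apply_symm_apply] at this
  have ha' : a⁻¹ = a := inv_eq_of_mul_eq_one_left ha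
  have hb' : b⁻¹ = b := inv_eq_of_mul_eq_one_left hb
  have hconj : ∀ n : ℤ, b (((a * b) ^ n) x) = ((a * b) ^ (-n)) x := by
    intro n
    have h1 : b * (a * b) * b⁻¹ = (a * b)⁻¹ := by
      rw [mul_inv_rev, ha', hb']; simp [mul_assoc, hb]
    have h2 : b * (a * b) ^ n * b⁻¹ = (a * b) ^ (-n) := by
      rw [← conj_zpow, h1, inv_zpow, zpow_neg]
    rw [← h2, hb', Equiv.Perm.mul_apply, Equiv.Perm.mul_apply, hbx]
  have horb : ∀ y, glue α β x y ↔ ∃ n : ℤ, y = ((a * b) ^ n) x := by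
    intro y
    constructor
    · intro h
      refine hcl {y | ∃ n : ℤ, y = ((a * b) ^ n) x} ?_ ?_ x y h ⟨0, rfl⟩
      · rintro _ ⟨n, rfl⟩
        refine ⟨1 - n, ?_⟩
        have : ∀ z, a z = (a * b) (b z) := fun z => by
          rw [← Equiv.Perm.mul_apply, mul_assoc, hb, mul_one]
        rw [this, hconj, ← Equiv.Perm.mul_apply, ← zpow_one_add, sub_eq_add_neg]
      · rintro _ ⟨n, rfl⟩
        exact ⟨-n, hconj n⟩
    · rintro ⟨n, rfl⟩; exact hpow n
  have hfin : ∃ m n : ℤ, m ≠ n ∧ ∃ k : ℤ, ((a * b) ^ m) x = (rowShift N ^ k) (((a * b) ^ n) x) := by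
    obtain ⟨m, n, hmn, h⟩ := Finite.exists_ne_map_eq_of_infinite (fun n : ℤ =>
      ((⟨(((a * b) ^ n) x).1, by have := glue_row (hpow n) hx2; omega⟩ : Fin 3),
        ((((a * b) ^ n) x).2 : ZMod N)))
    simp only [Prod.mk.injEq, Fin.mk.injEq] at h
    obtain ⟨k, hk⟩ := (ZMod.intCast_eq_intCast_iff_dvd_sub _ _ _).1 h.2.symm
    refine ⟨m, n, hmn, k, ?_⟩
    rw [rowShift_zpow]
    refine Prod.ext h.1 ?_
    simp only; rw [mul_comm k, ← hk]; ring
  obtain ⟨d, hd, hdx⟩ := dihedral_period a b (rowShift N) ha hb hsa hsb x hbx hfin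
  constructor
  · refine ((Set.finite_Ico (0 : ℤ) d).image (fun n => ((a * b) ^ n) x)).subset ?_
    intro y hy
    obtain ⟨n, rfl⟩ := (horb y).1 hy
    refine ⟨n % d, ⟨Int.emod_nonneg _ (by omega), Int.emod_lt_of_pos _ (by omega)⟩, ?_⟩
    have e : ((a * b) ^ ((d : ℤ) * (n / d))) x = x := by
      rw [zpow_mul, zpow_natCast]
      exact Function.IsFixedPt.perm_zpow hdx _
    conv_rhs => rw [← Int.emod_add_mul_ediv n d, zpow_add, Equiv.Perm.mul_apply, e]
  · simp only [horb]
    exact dihedral_unique a b ha hb x hbx hax ⟨d, hd, hdx⟩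

theorem glue_boundary (α β : AffineDiagram N) (x : ℤ ⊕ ℤ) :
    {y | glue α β (place 0 2 x) y}.Finite ∧
      ∃! y, y ≠ x ∧ glue α β (place 0 2 x) (place 0 2 y) := by
  set a := α.rowPerm 0 1 (by norm_num) with ha
  set b := β.rowPerm 1 2 (by norm_num) with hb
  have hga : ∀ p, glue α β p (a p) := fun p => glue_of_left (α.onRows_rowFun (by norm_num) p)
  have hgb : ∀ p, glue α β p (b p) := fun p => glue_of_right (β.onRows_rowFun (by norm_num) p)
  have haf : ∀ p, a p = p ↔ p.1 ≠ 0 ∧ p.1 ≠ 1 := fun p => α.rowFun_fixed (by norm_num)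
  have hbf : ∀ p, b p = p ↔ p.1 ≠ 1 ∧ p.1 ≠ 2 := fun p => β.rowFun_fixed (by norm_num)
  have key : {y | glue α β (place 0 2 x) y}.Finite ∧
      ∃! y, y ≠ place 0 2 x ∧ glue α β (place 0 2 x) y ∧ (a y = y ∨ b y = y) := by
    rcases x with i | i
    · exact orbit_aux α β a b (α.rowPerm_sq _) (β.rowPerm_sq _) (α.commute_rowPerm _)
        (β.commute_rowPerm _) hga hgb (fun O h h' p q hpq hp => glue_closed O h h' hpq hp) _
        (by simp [place]) (by simp [hbf, place]) (by simp [haf, place])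
    · simp only [or_comm (a := a _ = _)]
      exact orbit_aux α β b a (β.rowPerm_sq _) (α.rowPerm_sq _) (β.commute_rowPerm _)
        (α.commute_rowPerm _) hgb hga (fun O h h' p q hpq hp => glue_closed O h' h hpq hp) _
        (by simp [place]) (by simp [haf, place]) (by simp [hbf, place])
  refine ⟨key.1, ?_⟩
  obtain ⟨y, ⟨hy1, hy2, hy3⟩, hy4⟩ := key.2
  have hx2 : (place 0 2 x).1 ≤ 2 := by rcases x with i | i <;> simp [place]
  have hb1 : ∀ z : ℤ ⊕ ℤ, (place 0 2 z).1 ≠ 1 := by rintro (i | i) <;> simp [place]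
  rcases place_cases 0 2 y with ⟨z, rfl⟩ | ⟨h1, h2⟩
  · refine ⟨z, ⟨fun h => hy1 (by rw [h]), hy2⟩, ?_⟩
    intro w ⟨hw1, hw2⟩
    apply place_injective (r := 0) (s := 2) (by norm_num)
    refine hy4 _ ⟨fun h => hw1 (place_injective (by norm_num) h), hw2, ?_⟩
    rw [haf, hbf]
    have := hb1 w
    omega
  · exfalso
    have := glue_row hy2 hx2
    rw [haf, hbf] at hy3
    omega

/-! ### Gluing keeps diagrams planar -/

/-- `1` if `x` comes before `y`, and `0` otherwise. -/
def sgn : ℤ ⊕ ℤ → ℤ ⊕ ℤ → ZMod 2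
  | .inl i, .inl j => if i < j then 1 else 0
  | .inl _, .inr _ => 1
  | .inr _, .inl _ => 0
  | .inr i, .inr j => if j < i then 1 else 0

theorem before_iff (x y : ℤ ⊕ ℤ) :
    Before x y ↔ toLex (Sum.map id OrderDual.toDual x : ℤ ⊕ ℤᵒᵈ) <
      toLex (Sum.map id OrderDual.toDual y : ℤ ⊕ ℤᵒᵈ) := by
  rcases x with i | i <;> rcases y with j | j <;> simp [Before]

theorem sgn_eq (x y : ℤ ⊕ ℤ) : sgn x y =
    if toLex (Sum.map id OrderDual.toDual x : ℤ ⊕ ℤᵒᵈ) <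
      toLex (Sum.map id OrderDual.toDual y : ℤ ⊕ ℤᵒᵈ) then 1 else 0 := by
  rcases x with i | i <;> rcases y with j | j <;> simp [sgn]

theorem four_points {X : Type*} [LinearOrder X] (u v u' v' : X) (h1 : u ≠ v) (h2 : u ≠ v')
    (h3 : u' ≠ v) (h4 : u' ≠ v')
    (n1 : ¬ (u < v ∧ v < u' ∧ u' < v')) (n2 : ¬ (u < v' ∧ v' < u' ∧ u' < v))
    (n3 : ¬ (u' < v ∧ v < u ∧ u < v')) (n4 : ¬ (u' < v' ∧ v' < u ∧ u < v))
    (n5 : ¬ (v < u ∧ u < v' ∧ v' < u')) (n6 : ¬ (v < u' ∧ u' < v' ∧ v' < u))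
    (n7 : ¬ (v' < u ∧ u < v ∧ v < u')) (n8 : ¬ (v' < u' ∧ u' < v ∧ v < u)) :
    ((if u < v then 1 else 0 : ZMod 2) + (if u < v' then 1 else 0)) +
      ((if u' < v then 1 else 0) + (if u' < v' then 1 else 0)) = 0 := by
  have e2 : (1 + 1 : ZMod 2) = 0 := by decide
  have := h1.lt_or_gt
  have := h2.lt_or_gt
  have := h3.lt_or_gt
  have := h4.lt_or_gt
  split_ifs <;> first | (simp [e2]; done) | (exfalso; grind)

theorem sgn_arcs (α : AffineDiagram N) (u v : ℤ ⊕ ℤ) (h : ¬ α.arcs u v) :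
    (sgn u v + sgn u (α.partner v)) +
      (sgn (α.partner u) v + sgn (α.partner u) (α.partner v)) = 0 := by
  have hu := α.arcs_partner u
  have hv := α.arcs_partner v
  have hu' := α.arcs.symm' hu
  have hv' := α.arcs.symm' hv
  have inj : Function.Injective (fun x : ℤ ⊕ ℤ =>
      toLex (Sum.map id OrderDual.toDual x : ℤ ⊕ ℤᵒᵈ)) := by
    rintro (i | i) (j | j) h <;> simp at h ⊢ <;> exact h
  simp only [sgn_eq]
  have nc := α.noncrossing
  simp only [before_iff] at nc
  have key := four_points
    (toLex (Sum.map id OrderDual.toDual u : ℤ ⊕ ℤᵒᵈ))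
    (toLex (Sum.map id OrderDual.toDual v : ℤ ⊕ ℤᵒᵈ))
    (toLex (Sum.map id OrderDual.toDual (α.partner u) : ℤ ⊕ ℤᵒᵈ))
    (toLex (Sum.map id OrderDual.toDual (α.partner v) : ℤ ⊕ ℤᵒᵈ))
    (fun e => h (by rw [inj e]))
    (fun e => h (by rw [inj e]; exact hv'))
    (fun e => h (by rw [← inj e]; exact hu))
    (fun e => h (α.arcs.trans' hu (by rw [inj e]; exact hv')))
    (fun e => nc _ _ _ _ e.1 e.2.1 e.2.2 hu hv)
    (fun e => nc _ _ _ _ e.1 e.2.1 e.2.2 hu hv')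
    (fun e => nc _ _ _ _ e.1 e.2.1 e.2.2 hu' hv)
    (fun e => nc _ _ _ _ e.1 e.2.1 e.2.2 hu' hv')
    (fun e => nc _ _ _ _ e.1 e.2.1 e.2.2 hv hu)
    (fun e => nc _ _ _ _ e.1 e.2.1 e.2.2 hv hu')
    (fun e => nc _ _ _ _ e.1 e.2.1 e.2.2 hv' hu)
    (fun e => nc _ _ _ _ e.1 e.2.1 e.2.2 hv' hu')
  exact key

theorem parity_card (α : AffineDiagram N) (Q : Finset (ℤ ⊕ ℤ)) (hQ : ∀ u ∈ Q, α.partner u ∈ Q) :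
    (Q.card : ZMod 2) = 0 := by
  rw [Finset.card_eq_sum_ones, Nat.cast_sum]
  exact Finset.sum_involution (fun u _ => α.partner u) (fun _ _ => by decide)
    (fun u _ _ => α.partner_ne u) hQ (fun u _ => α.partner_partner u)

theorem parity_sum (α : AffineDiagram N) (Q : Finset (ℤ ⊕ ℤ)) (hQ : ∀ u ∈ Q, α.partner u ∈ Q)
    (x : ℤ ⊕ ℤ) (hx : x ∉ Q) : ∑ u ∈ Q, sgn u x = ∑ u ∈ Q, sgn u (α.partner x) := by
  have h : ∑ u ∈ Q, (sgn u x + sgn u (α.partner x)) = 0 := by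
    refine Finset.sum_involution (fun u _ => α.partner u) (fun u hu => ?_)
      (fun u _ _ => α.partner_ne u) hQ (fun u _ => α.partner_partner u)
    apply sgn_arcs
    intro h
    rcases α.arcs_iff.1 h with rfl | rfl
    · exact hx hu
    · exact hx (hQ u hu)
  rw [Finset.sum_add_distrib] at h
  rw [← sub_eq_zero, CharTwo.sub_eq_add]; exact h

/-- The points of a finite set on the line `r`. -/
noncomputable def row (P : Finset (ℕ × ℤ)) (r : ℕ) : Finset ℤ :=
  P.preimage (fun i => (r, i)) (Function.Injective.injOn fun _ _ h => (Prod.mk.inj h).2)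

theorem mem_row {P : Finset (ℕ × ℤ)} {r : ℕ} {i : ℤ} : i ∈ row P r ↔ (r, i) ∈ P := by
  unfold row; rw [Finset.mem_preimage]

theorem mem_rows {P : Finset (ℕ × ℤ)} {r s : ℕ} {x : ℤ ⊕ ℤ} :
    x ∈ (row P r).disjSum (row P s) ↔ place r s x ∈ P := by
  rcases x with i | i <;> simp [mem_row, place]

/-- Parity of the number of points of `P` on one side of a point. -/
noncomputable def winding (P : Finset (ℕ × ℤ)) : ℕ × ℤ → ZMod 2
  | (0, v) => ∑ u ∈ row P 0, (if u < v then 1 else 0)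
  | (1, v) => ∑ u ∈ row P 1, (if u < v then 1 else 0)
  | (_, v) => ((row P 0).card : ZMod 2) + ∑ u ∈ row P 2, (if v < u then 1 else 0)

theorem sum_sgn_inl (A B : Finset ℤ) (v : ℤ) :
    ∑ u ∈ A.disjSum B, sgn u (Sum.inl v) = ∑ u ∈ A, (if u < v then 1 else 0 : ZMod 2) := by
  simp [Finset.sum_disjSum, sgn]

theorem sum_sgn_inr (A B : Finset ℤ) (v : ℤ) :
    ∑ u ∈ A.disjSum B, sgn u (Sum.inr v) =
      (A.card : ZMod 2) + ∑ u ∈ B, (if v < u then 1 else 0 : ZMod 2) := by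
  simp [Finset.sum_disjSum, sgn]

theorem sum_lt_add_sum_gt (A : Finset ℤ) (v : ℤ) (hv : v ∉ A) :
    ∑ u ∈ A, (if u < v then 1 else 0 : ZMod 2) + ∑ u ∈ A, (if v < u then 1 else 0 : ZMod 2) =
      A.card := by
  rw [← Finset.sum_add_distrib, Finset.card_eq_sum_ones, Nat.cast_sum]
  refine Finset.sum_congr rfl fun u hu => ?_
  have : u ≠ v := fun h => hv (h ▸ hu)
  rcases this.lt_or_gt with h | h <;> simp [h, h.le]

theorem parity_rows {α β : AffineDiagram N} (P : Finset (ℕ × ℤ))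
    (hP : ∀ p q, glue α β p q → p ∈ P → q ∈ P) :
    ((row P 0).card : ZMod 2) = (row P 1).card ∧
    ((row P 1).card : ZMod 2) = (row P 2).card := by
  have h1 := parity_card α ((row P 0).disjSum (row P 1)) (fun u hu => by
    rw [mem_rows] at hu ⊢
    exact hP _ _ (glue_of_left (onRows_of_arcs (α.arcs_partner u))) hu)
  have h2 := parity_card β ((row P 1).disjSum (row P 2)) (fun u hu => by
    rw [mem_rows] at hu ⊢
    exact hP _ _ (glue_of_right (onRows_of_arcs (β.arcs_partner u))) hu)
  rw [Finset.card_disjSum, Nat.cast_add] at h1 h2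
  constructor
  · rw [← sub_eq_zero, CharTwo.sub_eq_add]; exact h1
  · rw [← sub_eq_zero, CharTwo.sub_eq_add]; exact h2

theorem winding_eq {α β : AffineDiagram N} (P : Finset (ℕ × ℤ))
    (hP : ∀ p q, glue α β p q → p ∈ P → q ∈ P) {p q : ℕ × ℤ} (hpq : glue α β p q) (hp : p ∉ P) :
    winding P p = winding P q := by
  classical
  obtain ⟨hc1, hc2⟩ := parity_rows P hP
  have key : glue α β ≤ Setoid.ker (fun p => if p ∈ P then none else some (winding P p)) := by
    refine glue_le ?_ ?_
    · intro x y hxy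
      have hxy' := glue_of_left (β := β) (onRows_of_arcs (r := 0) (s := 1) hxy)
      rw [Setoid.ker_def]
      by_cases hx : place 0 1 x ∈ P
      · rw [if_pos hx, if_pos (hP _ _ hxy' hx)]
      · have hy : place 0 1 y ∉ P := fun h => hx (hP _ _ (Setoid.symm' _ hxy') h)
        rw [if_neg hx, if_neg hy, Option.some_inj]
        have hw : ∀ z, place 0 1 z ∉ P → winding P (place 0 1 z) =
            ∑ u ∈ (row P 0).disjSum (row P 1), sgn u z := by
          rintro (v | v) hv
          · rw [sum_sgn_inl]; rfl
          · have := sum_lt_add_sum_gt (row P 1) v (by rw [mem_row]; exact hv)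
            rw [sum_sgn_inr, hc1, ← this, add_assoc, CharTwo.add_self_eq_zero, add_zero]
            rfl
        rw [hw _ hx, hw _ hy]
        rcases α.arcs_iff.1 hxy with rfl | rfl
        · rfl
        · refine parity_sum α _ (fun u hu => ?_) _ (by rwa [mem_rows])
          rw [mem_rows] at hu ⊢
          exact hP _ _ (glue_of_left (onRows_of_arcs (α.arcs_partner u))) hu
    · intro x y hxy
      have hxy' := glue_of_right (α := α) (onRows_of_arcs (r := 1) (s := 2) hxy)
      rw [Setoid.ker_def]
      by_cases hx : place 1 2 x ∈ P
      · rw [if_pos hx, if_pos (hP _ _ hxy' hx)]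
      · have hy : place 1 2 y ∉ P := fun h => hx (hP _ _ (Setoid.symm' _ hxy') h)
        rw [if_neg hx, if_neg hy, Option.some_inj]
        have hw : ∀ z, winding P (place 1 2 z) =
            ∑ u ∈ (row P 1).disjSum (row P 2), sgn u z := by
          rintro (v | v)
          · rw [sum_sgn_inl]; rfl
          · rw [sum_sgn_inr, ← hc1]; rfl
        rw [hw, hw]
        rcases β.arcs_iff.1 hxy with rfl | rfl
        · rfl
        · refine parity_sum β _ (fun u hu => ?_) _ (by rwa [mem_rows])
          rw [mem_rows] at hu ⊢
          exact hP _ _ (glue_of_right (onRows_of_arcs (β.arcs_partner u))) hu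
  have h := key hpq
  have hq : q ∉ P := fun h => hp (hP _ _ (Setoid.symm' _ hpq) h)
  rw [Setoid.ker_def, if_neg hp, if_neg hq, Option.some_inj] at h
  exact h

theorem winding_place (P : Finset (ℕ × ℤ)) (y : ℤ ⊕ ℤ) :
    winding P (place 0 2 y) = ∑ u ∈ (row P 0).disjSum (row P 2), sgn u y := by
  rcases y with v | v
  · rw [sum_sgn_inl]; rfl
  · rw [sum_sgn_inr]; rfl

theorem exists_component (α β : AffineDiagram N) (x : ℤ ⊕ ℤ) :
    ∃ P : Finset (ℕ × ℤ), ∀ q, q ∈ P ↔ glue α β (place 0 2 x) q :=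
  ⟨(glue_boundary α β x).1.toFinset, fun q => by simp⟩

theorem boundary_component {α β : AffineDiagram N} {x y : ℤ ⊕ ℤ} {P : Finset (ℕ × ℤ)}
    (hP : ∀ q, q ∈ P ↔ glue α β (place 0 2 x) q) (hxy : y ≠ x)
    (h : glue α β (place 0 2 x) (place 0 2 y)) :
    (row P 0).disjSum (row P 2) = {x, y} := by
  ext z
  rw [mem_rows, hP, Finset.mem_insert, Finset.mem_singleton]
  constructor
  · intro hz
    by_cases e : z = x
    · exact Or.inl e
    · exact Or.inr ((glue_boundary α β x).2.unique ⟨e, hz⟩ ⟨hxy, h⟩)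
  · rintro (rfl | rfl)
    · exact Setoid.refl' _ _
    · exact h

theorem glue_noncrossing (α β : AffineDiagram N) (a b c d : ℤ ⊕ ℤ) (hab : Before a b)
    (hbc : Before b c) (hcd : Before c d) (hac : glue α β (place 0 2 a) (place 0 2 c)) :
    ¬ glue α β (place 0 2 b) (place 0 2 d) := by
  intro hbd
  rw [before_iff] at hab hbc hcd
  obtain ⟨P, hP⟩ := exists_component α β a
  have hca : c ≠ a := by rintro rfl; exact lt_asymm hab hbc
  have hbd' : b ≠ a ∧ b ≠ c := by
    constructor <;> rintro rfl
    · exact lt_irrefl _ hab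
    · exact lt_irrefl _ hbc
  have hb : place 0 2 b ∉ P := fun h =>
    hbd'.2 ((glue_boundary α β a).2.unique ⟨hbd'.1, (hP _).1 h⟩ ⟨hca, hac⟩)
  have hcl : ∀ p q, glue α β p q → p ∈ P → q ∈ P := fun p q h hp => by
    rw [hP] at hp ⊢; exact Setoid.trans' _ hp h
  have hw := winding_eq P hcl hbd hb
  rw [winding_place, winding_place, boundary_component hP hca hac,
    Finset.sum_pair hca.symm, Finset.sum_pair hca.symm] at hw
  simp only [sgn_eq] at hw
  rw [if_pos hab, if_neg hbc.not_gt, if_pos (hab.trans (hbc.trans hcd)), if_pos hcd] at hw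
  revert hw; decide

theorem Periodic.iterate {E : Setoid (ℕ × ℤ)} (hE : Periodic N E) {r : ℕ} {i k : ℤ}
    (h : E (r, i) (r, i + k * N)) (n : ℤ) : E (r, i) (r, i + n * k * N) := by
  induction n using Int.induction_on with
  | zero => simp
  | succ n ih =>
    refine E.trans' ih ?_
    have := hE (n * k) _ _ h
    convert this using 2; simp only; ring
  | pred n ih =>
    refine E.trans' ih (E.symm' ?_)
    have := hE ((-n - 1) * k) _ _ h
    convert this using 2; simp only; ring

theorem no_circle_of_through (α β : AffineDiagram N) (i j : ℤ)
    (hij : glue α β (0, i) (2, j)) (q k : ℤ) (hq : ∀ p, glue α β (1, q) p → p.1 = 1)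
    (hk : k ≠ 0) : ¬ glue α β (1, q) (1, q + k * N) := by
  intro h
  obtain ⟨P, hP⟩ := exists_component α β (Sum.inl i)
  have hcl : ∀ p q, glue α β p q → p ∈ P → q ∈ P := fun p q h hp => by
    rw [hP] at hp ⊢; exact Setoid.trans' _ hp h
  have hb := boundary_component (y := Sum.inr j) hP (by simp) hij
  have hrow0 : row P 0 = {i} := by
    ext u
    have := Finset.ext_iff.1 hb (Sum.inl u)
    simpa using this
  have hc := (parity_rows P hcl).1
  rw [hrow0, Finset.card_singleton] at hc
  have hqP : (1, q) ∉ P := fun hh => by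
    have := hq _ (Setoid.symm' _ ((hP _).1 hh))
    simp [place] at this
  obtain ⟨M, hM⟩ : ∃ M : ℤ, ∀ u ∈ row P 1, |u| ≤ M := by
    obtain ⟨M, hM⟩ := ((row P 1).image (fun u => |u|)).bddAbove
    exact ⟨M, fun u hu => hM (by simpa using ⟨u, hu, rfl⟩)⟩
  have hN : (N : ℤ) ≠ 0 := by exact_mod_cast NeZero.ne N
  have hw : ∀ n : ℤ, winding P (1, q) = winding P (1, q + n * k * N) := fun n =>
    winding_eq P hcl ((periodic_glue α β).iterate h n) hqP
  have hpos : 1 ≤ (k * N) ^ 2 := by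
    have : k * N ≠ 0 := mul_ne_zero hk hN
    have := pow_pos (abs_pos.2 this) 2
    rw [sq_abs] at this; omega
  have hbig : |M| + |q| + 1 ≤ (|M| + |q| + 1) * (k * N) ^ 2 :=
    le_mul_of_one_le_right (by positivity) hpos
  have h1 : winding P (1, q + ((|M| + |q| + 1) * (k * N)) * k * N) = (row P 1).card := by
    rw [Finset.card_eq_sum_ones, Nat.cast_sum]
    simp only [winding]
    refine Finset.sum_congr rfl fun u hu => ?_
    rw [if_pos]
    · simp
    · have e := hM u hu
      have : (|M| + |q| + 1) * (k * N) * k * N = (|M| + |q| + 1) * (k * N) ^ 2 := by ring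
      rw [this]
      have := le_abs_self u; have := le_abs_self M; have := neg_abs_le q
      linarith
  have h2 : winding P (1, q + (-(|M| + |q| + 1) * (k * N)) * k * N) = 0 := by
    simp only [winding]
    refine Finset.sum_eq_zero fun u hu => ?_
    rw [if_neg]
    have e := hM u hu
    have : -(|M| + |q| + 1) * (k * N) * k * N = -((|M| + |q| + 1) * (k * N) ^ 2) := by ring
    rw [this]
    have := neg_abs_le u; have := le_abs_self M; have := le_abs_self q
    linarith
  rw [← hw] at h1 h2
  rw [h1, ← hc] at h2
  revert h2; decide

theorem newCircles_eq_zero (α β : AffineDiagram N) (i j : ℤ)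
    (hij : glue α β (0, i) (2, j)) : newCircles α β = 0 := by
  unfold newCircles
  suffices components N (glue α β) 1 True = ∅ by rw [this, Set.ncard_empty]
  rw [Set.eq_empty_iff_forall_notMem]
  rintro C ⟨q, hq, h, -⟩
  obtain ⟨k, hk, h⟩ := h.2 trivial
  exact no_circle_of_through α β i j hij q k hq hk h

theorem exists_through_left {α β : AffineDiagram N} {i j : ℤ} (hij : glue α β (0, i) (2, j)) :
    ∃ k l, α.arcs (Sum.inl k) (Sum.inr l) := by
  by_contra! hno
  have key : glue α β ≤ Setoid.ker (fun p => p.1 = 0) := by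
    refine glue_le ?_ ?_
    · rintro (x | x) (y | y) h
      · rfl
      · exact absurd h (hno _ _)
      · exact absurd (α.arcs.symm' h) (hno _ _)
      · rfl
    · rintro (x | x) (y | y) h <;> simp [Setoid.ker_def, place]
  have := key hij
  simp [Setoid.ker_def] at this

theorem exists_through_right {α β : AffineDiagram N} {i j : ℤ} (hij : glue α β (0, i) (2, j)) :
    ∃ k l, β.arcs (Sum.inl k) (Sum.inr l) := by
  by_contra! hno
  have key : glue α β ≤ Setoid.ker (fun p => p.1 = 2) := by
    refine glue_le ?_ ?_
    · rintro (x | x) (y | y) h <;> simp [Setoid.ker_def, place]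
    · rintro (x | x) (y | y) h
      · rfl
      · exact absurd h (hno _ _)
      · exact absurd (β.arcs.symm' h) (hno _ _)
      · rfl
  have := key hij
  simp [Setoid.ker_def] at this

theorem Periodic.iff {E : Setoid (ℕ × ℤ)} (hE : Periodic N E) (k : ℤ) (p q : ℕ × ℤ) :
    E (p.1, p.2 + k * N) (q.1, q.2 + k * N) ↔ E p q := by
  refine ⟨fun h => ?_, hE k p q⟩
  have := hE (-k) _ _ h
  simpa using this

/-- The diagram `α ∘ β`: glue the bottom of `α` to the top of `β` and remove the contractible
loops. -/
noncomputable def comp (α β : AffineDiagram N) : AffineDiagram N where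
  arcs := (glue α β).comap (place 0 2)
  existsUnique_partner x := (glue_boundary α β x).2
  periodic x y := by
    have := (periodic_glue α β).iff 1 (place 0 2 x) (place 0 2 y)
    rw [one_mul] at this
    change glue α β (place 0 2 (shift N x)) (place 0 2 (shift N y)) ↔
      glue α β (place 0 2 x) (place 0 2 y)
    rw [place_shift, place_shift]
    exact this
  noncrossing := glue_noncrossing α β
  circles := α.circles + β.circles + newCircles α β
  circles_eq_zero i j h := by
    obtain ⟨k, l, hl⟩ := exists_through_left h
    obtain ⟨k', l', hr⟩ := exists_through_right h
    rw [α.circles_eq_zero k l hl, β.circles_eq_zero k' l' hr, newCircles_eq_zero α β i j h]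

/-! ### Associativity and unit -/

/-- Points of the line `t` are related to nothing else. -/
def Isolated (E : Setoid (ℕ × ℤ)) (t : ℕ) : Prop := ∀ p q, E p q → p.1 = t → p = q

theorem Isolated.sup {E F : Setoid (ℕ × ℤ)} {t : ℕ} (hE : Isolated E t) (hF : Isolated F t) :
    Isolated (E ⊔ F) t := by
  intro p q h hp
  have key : ∀ {G : Setoid (ℕ × ℤ)}, Isolated G t →
      G ≤ Setoid.ker (fun p : ℕ × ℤ => if p.1 = t then some p else none) := by
    intro G hG p q hpq
    rw [Setoid.ker_def]
    by_cases hp : p.1 = t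
    · rw [hG p q hpq hp]
    · by_cases hq : q.1 = t
      · rw [hG q p (G.symm' hpq) hq]
      · rw [if_neg hp, if_neg hq]
  have := sup_le (key hE) (key hF) h
  rw [Setoid.ker_def, if_pos hp] at this
  by_cases hq : q.1 = t
  · rw [if_pos hq] at this; exact Option.some_injective _ this
  · rw [if_neg hq] at this; exact absurd this (by simp)

theorem isolated_onRows (α : AffineDiagram N) {r s t : ℕ} (hr : t ≠ r) (hs : t ≠ s) :
    Isolated (α.onRows r s) t := by
  intro p q h hp
  have key : α.onRows r s ≤ Setoid.ker (fun p : ℕ × ℤ => if p.1 = t then some p else none) := by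
    refine onRows_le ?_
    have : ∀ x, (place r s x).1 ≠ t := by rintro (i | i) <;> simp [place, hr.symm, hs.symm]
    intro x y _
    rw [Setoid.ker_def, if_neg (this x), if_neg (this y)]
  have := key h
  rw [Setoid.ker_def, if_pos hp] at this
  by_cases hq : q.1 = t
  · rw [if_pos hq] at this; exact Option.some_injective _ this
  · rw [if_neg hq] at this; exact absurd this (by simp)

/-- Forgetting the points of a row. -/
theorem sup_iff_of_hide {F G D : Setoid (ℕ × ℤ)} {h : ℕ} (hG : Isolated G h)
    (hD : ∀ p q, D p q ↔ p = q ∨ (p.1 ≠ h ∧ q.1 ≠ h ∧ F p q)) {p q : ℕ × ℤ}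
    (hp : p.1 ≠ h) (hq : q.1 ≠ h) : (F ⊔ G) p q ↔ (D ⊔ G) p q := by
  constructor
  · intro hpq
    let φ : ℕ × ℤ → Set (ℕ × ℤ) := fun p => {y | ∃ z, z.1 ≠ h ∧ F p z ∧ (D ⊔ G) z y}
    have hF : F ≤ Setoid.ker φ := by
      intro a b hab
      rw [Setoid.ker_def]
      ext y
      exact ⟨fun ⟨z, h1, h2, h3⟩ => ⟨z, h1, F.trans' (F.symm' hab) h2, h3⟩,
        fun ⟨z, h1, h2, h3⟩ => ⟨z, h1, F.trans' hab h2, h3⟩⟩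
    have hφ : ∀ a : ℕ × ℤ, a.1 ≠ h → φ a = {y | (D ⊔ G) a y} := by
      intro a ha
      ext y
      constructor
      · rintro ⟨z, h1, h2, h3⟩
        have : D a z := (hD a z).2 (Or.inr ⟨ha, h1, h2⟩)
        exact (D ⊔ G).trans' ((le_sup_left : D ≤ D ⊔ G) this) h3
      · intro hy
        exact ⟨a, ha, F.refl' a, hy⟩
    have hGφ : G ≤ Setoid.ker φ := by
      intro a b hab
      rw [Setoid.ker_def]
      by_cases ha : a.1 = h
      · rw [hG a b hab ha]
      by_cases hb : b.1 = h
      · rw [hG b a (G.symm' hab) hb]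
      have hab' := (le_sup_right : G ≤ D ⊔ G) hab
      rw [hφ a ha, hφ b hb]
      ext y
      exact ⟨fun hh => (D ⊔ G).trans' ((D ⊔ G).symm' hab') hh, fun hh => (D ⊔ G).trans' hab' hh⟩
    have := sup_le hF hGφ hpq
    rw [Setoid.ker_def, hφ p hp, hφ q hq] at this
    have hqq : q ∈ {y | (D ⊔ G) q y} := (D ⊔ G).refl' q
    rw [← this] at hqq
    exact hqq
  · intro hpq
    have hDF : D ≤ F := by
      intro a b hab
      rcases (hD a b).1 hab with rfl | hh
      · exact F.refl' _
      · exact hh.2.2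
    exact sup_le_sup_right hDF G hpq

theorem sup_iff_of_inside {F G : Setoid (ℕ × ℤ)} {h : ℕ} (hG : Isolated G h) {p q : ℕ × ℤ}
    (hp : ∀ y, F p y → y.1 = h) : (F ⊔ G) p q ↔ F p q := by
  refine ⟨fun hpq => ?_, fun hpq => (le_sup_left : F ≤ F ⊔ G) hpq⟩
  have h1 : F ≤ Setoid.ker (fun y => F p y) := fun a b hab => by
    rw [Setoid.ker_def]
    exact propext ⟨fun hh => F.trans' hh hab, fun hh => F.trans' hh (F.symm' hab)⟩
  have h2 : G ≤ Setoid.ker (fun y => F p y) := fun a b hab => by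
    rw [Setoid.ker_def]
    refine propext ⟨fun hh => ?_, fun hh => ?_⟩
    · rwa [← hG a b hab (hp a hh)]
    · rwa [← hG b a (G.symm' hab) (hp b hh)]
  have := sup_le h1 h2 hpq
  rw [Setoid.ker_def] at this
  rw [← this]

theorem components_finite {E : Setoid (ℕ × ℤ)} (hE : Periodic N E) (r : ℕ) (ess : Prop) :
    (components N E r ess).Finite := by
  refine ((Set.finite_Ico (0 : ℤ) N).image
    (fun i => {j | ∃ k : ℤ, E (r, i) (r, j + k * N)})).subset ?_
  rintro C ⟨i, -, -, rfl⟩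
  have hN : (0 : ℤ) < N := by exact_mod_cast NeZero.pos N
  refine ⟨i % N, ⟨Int.emod_nonneg _ hN.ne', Int.emod_lt_of_pos _ hN⟩, ?_⟩
  have hi : i % N + (i / N) * N = i := by rw [mul_comm]; exact Int.emod_add_mul_ediv i N
  ext j
  constructor
  · rintro ⟨k, hk⟩
    refine ⟨k + i / N, ?_⟩
    have := hE (i / N) _ _ hk
    simp only [hi] at this
    convert this using 2; ring
  · rintro ⟨k, hk⟩
    refine ⟨k - i / N, ?_⟩
    have := hE (-(i / N)) _ _ hk
    simp only at this
    convert this using 2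
    · linarith
    · ring

/-- The closed curves that only meet the lines `h` and `v`. -/
def bigComponents (N : ℕ) (E : Setoid (ℕ × ℤ)) (h v : ℕ) (ess : Prop) : Set (Set (ℕ × ℤ)) :=
  {K | ∃ x : ℕ × ℤ, (∀ y, E x y → y.1 = h ∨ y.1 = v) ∧
    ((∃ k : ℤ, k ≠ 0 ∧ E x (x.1, x.2 + k * N)) ↔ ess) ∧
    K = {y | ∃ k : ℤ, E x (y.1, y.2 + k * N)}}

theorem bigComponents_comm (N : ℕ) (E : Setoid (ℕ × ℤ)) (h v : ℕ) (ess : Prop) :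
    bigComponents N E h v ess = bigComponents N E v h ess := by
  unfold bigComponents; simp only [or_comm]

theorem Periodic.class_eq {E : Setoid (ℕ × ℤ)} (hE : Periodic N E) {x z : ℕ × ℤ} {k : ℤ}
    (h : E x (z.1, z.2 + k * N)) :
    {y : ℕ × ℤ | ∃ k : ℤ, E x (y.1, y.2 + k * N)} = {y | ∃ k : ℤ, E z (y.1, y.2 + k * N)} := by
  ext y
  constructor
  · rintro ⟨l, hl⟩
    refine ⟨l - k, ?_⟩
    have := hE (-k) _ _ (E.trans' (E.symm' h) hl)
    simp only at this
    convert this using 2 <;> ring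
  · rintro ⟨l, hl⟩
    refine ⟨l + k, E.trans' h ?_⟩
    have := hE k _ _ hl
    simp only at this
    convert this using 2; ring

theorem Periodic.ess_iff {E : Setoid (ℕ × ℤ)} (hE : Periodic N E) {x z : ℕ × ℤ}
    (h : E x z) : (∃ k : ℤ, k ≠ 0 ∧ E x (x.1, x.2 + k * N)) ↔
      ∃ k : ℤ, k ≠ 0 ∧ E z (z.1, z.2 + k * N) := by
  constructor
  · rintro ⟨k, hk, hh⟩
    exact ⟨k, hk, E.trans' (E.symm' h) (E.trans' hh (hE k _ _ h))⟩
  · rintro ⟨k, hk, hh⟩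
    exact ⟨k, hk, E.trans' h (E.trans' hh (hE k _ _ (E.symm' h)))⟩

theorem ncard_bigComponents {F G D : Setoid (ℕ × ℤ)} {h v : ℕ} (hv : v ≠ h) (hG : Isolated G h)
    (hD : ∀ p q, D p q ↔ p = q ∨ (p.1 ≠ h ∧ q.1 ≠ h ∧ F p q))
    (pF : Periodic N F) (pG : Periodic N G) (ess : Prop) :
    (bigComponents N (F ⊔ G) h v ess).ncard =
      (components N F h ess).ncard + (components N (D ⊔ G) v ess).ncard := by
  have pR : Periodic N (F ⊔ G) := pF.sup pG
  have pD : Periodic N D := by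
    intro k p q hpq
    rcases (hD p q).1 hpq with rfl | ⟨h1, h2, h3⟩
    · exact D.refl' _
    · exact (hD _ _).2 (Or.inr ⟨h1, h2, pF k _ _ h3⟩)
  have isoD : Isolated D h := by
    intro p q hpq hp
    rcases (hD p q).1 hpq with rfl | ⟨h1, h2, h3⟩
    · rfl
    · exact absurd hp h1
  have isoDG := isoD.sup hG
  set T2 : Set (Set (ℕ × ℤ)) := {K ∈ bigComponents N (F ⊔ G) h v ess | ∃ j, (v, j) ∈ K} with hT2
  set f1 : Set ℤ → Set (ℕ × ℤ) := fun C => (fun i => (h, i)) '' C with hf1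
  set tr : Set (ℕ × ℤ) → Set ℤ := fun K => {j | (v, j) ∈ K} with htr
  have f1inj : Function.Injective f1 :=
    Set.image_injective.2 fun _ _ e => (Prod.mk.inj e).2
  -- the trace map
  have htrace : tr '' T2 = components N (D ⊔ G) v ess := by
    ext C
    constructor
    · rintro ⟨K, ⟨⟨x, hx, he, rfl⟩, j, k, hj⟩, rfl⟩
      refine ⟨j + k * N, ?_, ?_, ?_⟩
      · intro y hy
        by_cases hyh : y.1 = h
        · have := isoDG _ _ ((D ⊔ G).symm' hy) hyh
          rw [this]
        · have := (sup_iff_of_hide hG hD (by exact hv) hyh).2 hy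
          exact (hx y ((F ⊔ G).trans' hj this)).resolve_left hyh
      · rw [← he, pR.ess_iff hj]
        refine exists_congr fun l => and_congr_right fun _ => ?_
        exact (sup_iff_of_hide hG hD hv hv).symm
      · ext i
        change (∃ l : ℤ, (F ⊔ G) x (v, i + l * N)) ↔ _
        refine exists_congr fun l => ?_
        refine Iff.trans ?_ (sup_iff_of_hide hG hD (by exact hv) (by exact hv))
        exact ⟨fun hh => (F ⊔ G).trans' ((F ⊔ G).symm' hj) hh, fun hh => (F ⊔ G).trans' hj hh⟩
    · rintro ⟨i, hi, he, rfl⟩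
      refine ⟨{y | ∃ k : ℤ, (F ⊔ G) (v, i) (y.1, y.2 + k * N)}, ⟨⟨(v, i), ?_, ?_, rfl⟩, i, 0, ?_⟩, ?_⟩
      · intro y hy
        by_cases hyh : y.1 = h
        · exact Or.inl hyh
        · exact Or.inr (hi y ((sup_iff_of_hide hG hD (by exact hv) hyh).1 hy))
      · rw [← he]
        refine exists_congr fun l => and_congr_right fun _ => ?_
        exact sup_iff_of_hide hG hD hv hv
      · simp
      · ext j
        refine exists_congr fun l => ?_
        exact sup_iff_of_hide hG hD hv hv
  have htrinj : Set.InjOn tr T2 := by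
    rintro K ⟨⟨x, -, -, rfl⟩, j, k, hj⟩ K' ⟨⟨x', -, -, rfl⟩, -⟩ hKK
    have hj' : j ∈ tr {y | ∃ k : ℤ, (F ⊔ G) x' (y.1, y.2 + k * N)} := by
      rw [← hKK]; exact ⟨k, hj⟩
    obtain ⟨k', hk'⟩ := hj'
    rw [pR.class_eq (z := (v, j)) hj, pR.class_eq (z := (v, j)) hk']
  have hsplit : bigComponents N (F ⊔ G) h v ess = f1 '' components N F h ess ∪ T2 := by
    ext K
    constructor
    · intro hK
      by_cases hKv : ∃ j, (v, j) ∈ K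
      · exact Or.inr ⟨hK, hKv⟩
      left
      obtain ⟨x, hx, he, rfl⟩ := hK
      have hx' : ∀ y, (F ⊔ G) x y → y.1 = h := by
        intro y hy
        refine (hx y hy).resolve_right fun hyv => hKv ⟨y.2, 0, ?_⟩
        rw [← hyv]; simpa using hy
      have hxF : ∀ y, F x y → y.1 = h := fun y hy => hx' y ((le_sup_left : F ≤ F ⊔ G) hy)
      have hxh : x.1 = h := hxF x (F.refl' x)
      obtain ⟨r, i⟩ := x
      obtain rfl : r = h := hxh
      refine ⟨{j | ∃ k : ℤ, F (r, i) (r, j + k * N)}, ⟨i, hxF, ?_, rfl⟩, ?_⟩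
      · rw [← he]
        refine exists_congr fun l => and_congr_right fun _ => ?_
        exact (sup_iff_of_inside hG hxF).symm
      · ext y
        constructor
        · rintro ⟨j, ⟨k, hk⟩, rfl⟩
          exact ⟨k, (sup_iff_of_inside hG hxF).2 hk⟩
        · rintro ⟨k, hk⟩
          have hy : y.1 = r := hx' (y.1, y.2 + k * N) hk
          refine ⟨y.2, ⟨k, ?_⟩, Prod.ext hy.symm rfl⟩
          rw [sup_iff_of_inside hG hxF, hy] at hk
          exact hk
    · rintro (⟨C, ⟨i, hi, he, rfl⟩, rfl⟩ | hK)
      · refine ⟨(h, i), ?_, ?_, ?_⟩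
        · intro y hy
          exact Or.inl (hi y ((sup_iff_of_inside hG hi).1 hy))
        · rw [← he]
          refine exists_congr fun l => and_congr_right fun _ => ?_
          exact sup_iff_of_inside hG hi
        · ext y
          constructor
          · rintro ⟨j, ⟨k, hk⟩, rfl⟩
            exact ⟨k, (sup_iff_of_inside hG hi).2 hk⟩
          · rintro ⟨k, hk⟩
            rw [sup_iff_of_inside hG hi] at hk
            have hy : y.1 = h := hi (y.1, y.2 + k * N) hk
            refine ⟨y.2, ⟨k, ?_⟩, Prod.ext hy.symm rfl⟩
            rw [hy] at hk
            exact hk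
      · exact hK.1
  have hdisj : Disjoint (f1 '' components N F h ess) T2 := by
    rw [Set.disjoint_left]
    rintro _ ⟨C, -, rfl⟩ ⟨-, j, i, -, hij⟩
    exact hv (Prod.mk.inj hij).1.symm
  have hfin2 : T2.Finite := by
    refine Set.Finite.of_finite_image ?_ htrinj
    rw [htrace]; exact components_finite (pD.sup pG) v ess
  rw [hsplit, Set.ncard_union_eq hdisj ((components_finite pF h ess).image f1) hfin2,
    Set.ncard_image_of_injective _ f1inj, ← htrace, htrinj.ncard_image]

theorem sup_rows_of {α β : AffineDiagram N} (f : ℕ → ℕ) {a b c : ℕ} {p q : ℕ × ℤ}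
    (h : (α.onRows a b ⊔ β.onRows b c) p q) :
    (α.onRows (f a) (f b) ⊔ β.onRows (f b) (f c)) (f p.1, p.2) (f q.1, q.2) := by
  have hpl : ∀ r s x, place (f r) (f s) x = (f (place r s x).1, (place r s x).2) := by
    rintro r s (i | i) <;> rfl
  have : α.onRows a b ⊔ β.onRows b c ≤
      (α.onRows (f a) (f b) ⊔ β.onRows (f b) (f c)).comap (fun p => (f p.1, p.2)) := by
    refine sup_le (onRows_le fun x y hxy => ?_) (onRows_le fun x y hxy => ?_)
    · rw [Setoid.comap_rel, ← hpl, ← hpl]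
      exact (le_sup_left : α.onRows (f a) (f b) ≤ _) (onRows_of_arcs hxy)
    · rw [Setoid.comap_rel, ← hpl, ← hpl]
      exact (le_sup_right : β.onRows (f b) (f c) ≤ α.onRows (f a) (f b) ⊔ β.onRows (f b) (f c))
        (onRows_of_arcs hxy)
  exact this h

theorem sup_rows_iff {α β : AffineDiagram N} (π : Equiv.Perm ℕ) {a b c : ℕ} (ha : π 0 = a)
    (hb : π 1 = b) (hc : π 2 = c) (p q : ℕ × ℤ) :
    (α.onRows a b ⊔ β.onRows b c) (π p.1, p.2) (π q.1, q.2) ↔ glue α β p q := by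
  subst ha hb hc
  constructor
  · intro h
    have := sup_rows_of π.symm h
    rw [Equiv.symm_apply_apply, Equiv.symm_apply_apply, Equiv.symm_apply_apply,
      Equiv.symm_apply_apply, Equiv.symm_apply_apply] at this
    exact this
  · intro h
    exact sup_rows_of π h

theorem components_rows {α β : AffineDiagram N} (π : Equiv.Perm ℕ) {a b c : ℕ} (ha : π 0 = a)
    (hb : π 1 = b) (hc : π 2 = c) (ess : Prop) :
    components N (α.onRows a b ⊔ β.onRows b c) b ess = components N (glue α β) 1 ess := by
  have key : ∀ i j : ℤ, (α.onRows a b ⊔ β.onRows b c) (b, i) (b, j) ↔ glue α β (1, i) (1, j) := by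
    intro i j
    have := sup_rows_iff (α := α) (β := β) π ha hb hc (1, i) (1, j)
    simpa [hb] using this
  unfold components
  ext C
  simp only [Set.mem_ofPred_eq, key]
  refine exists_congr fun i => and_congr_left fun _ => ?_
  have h2 := fun y => sup_rows_iff (α := α) (β := β) π ha hb hc (1, i) y
  simp only [hb] at h2
  constructor
  · intro hh y hy
    have := hh _ ((h2 y).2 hy)
    apply π.injective; rw [hb]; exact this
  · intro hh y hy
    have e : y = (π (π.symm y.1), y.2) := by simp
    rw [e] at hy
    have := hh _ ((h2 (π.symm y.1, y.2)).1 hy)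
    simp only [Equiv.symm_apply_eq, hb] at this
    exact this

theorem comp_onRows {α β : AffineDiagram N} (π : Equiv.Perm ℕ) {a b c : ℕ} (ha : π 0 = a)
    (hb : π 1 = b) (hc : π 2 = c) (p q : ℕ × ℤ) :
    (comp α β).onRows a c p q ↔
      p = q ∨ (p.1 ≠ b ∧ q.1 ≠ b ∧ (α.onRows a b ⊔ β.onRows b c) p q) := by
  have hpl : ∀ x, place a c x = (π (place 0 2 x).1, (place 0 2 x).2) := by
    rintro (i | i) <;> simp [place, ha, hc]
  have hab : a ≠ b := by rw [← ha, ← hb]; exact fun h => absurd (π.injective h) (by norm_num)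
  have hcb : c ≠ b := by rw [← hc, ← hb]; exact fun h => absurd (π.injective h) (by norm_num)
  have hplb : ∀ x, (place a c x).1 ≠ b := by rintro (i | i) <;> simp [place, hab, hcb]
  constructor
  · intro h
    let S : Setoid (ℕ × ℤ) :=
      { r := fun p q => p = q ∨ (p.1 ≠ b ∧ q.1 ≠ b ∧ (α.onRows a b ⊔ β.onRows b c) p q)
        iseqv := by
          refine ⟨fun p => Or.inl rfl, ?_, ?_⟩
          · rintro x y (rfl | ⟨h1, h2, h3⟩)
            · exact Or.inl rfl
            · exact Or.inr ⟨h2, h1, Setoid.symm' _ h3⟩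
          · rintro x y z (rfl | ⟨h1, h2, h3⟩) (rfl | ⟨h4, h5, h6⟩)
            · exact Or.inl rfl
            · exact Or.inr ⟨h4, h5, h6⟩
            · exact Or.inr ⟨h1, h2, h3⟩
            · exact Or.inr ⟨h1, h5, Setoid.trans' _ h3 h6⟩ }
    have key : (comp α β).onRows a c ≤ S := by
      refine onRows_le fun x y hxy => Or.inr ⟨hplb x, hplb y, ?_⟩
      rw [hpl, hpl, sup_rows_iff π ha hb hc]
      exact hxy
    exact key h
  · rintro (rfl | ⟨h1, h2, h3⟩)
    · exact Setoid.refl' _ _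
    · have hiso : ∀ p q : ℕ × ℤ, p.1 ≠ b → (α.onRows a b ⊔ β.onRows b c) p q →
          p = q ∨ ∃ x, p = place a c x := by
        intro p q hp hpq
        rcases place_cases a c p with ⟨x, hx⟩ | ⟨h4, h5⟩
        · exact Or.inr ⟨x, hx⟩
        · exact Or.inl (((α.isolated_onRows h4 hp).sup (β.isolated_onRows hp h5)) p q hpq rfl)
      rcases hiso p q h1 h3 with rfl | ⟨x, rfl⟩
      · exact Setoid.refl' _ _
      rcases hiso q _ h2 (Setoid.symm' _ h3) with rfl | ⟨y, rfl⟩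
      · exact Setoid.refl' _ _
      apply onRows_of_arcs
      rw [hpl, hpl, sup_rows_iff π ha hb hc] at h3
      exact h3

/-- Sends `0, 1, 2` to `0, 1, 3`. -/
def perm013 : Equiv.Perm ℕ := Equiv.swap 2 3

/-- Sends `0, 1, 2` to `0, 2, 3`. -/
def perm023 : Equiv.Perm ℕ := Equiv.swap 1 3 * Equiv.swap 1 2

/-- Sends `0, 1, 2` to `1, 2, 3`. -/
def perm123 : Equiv.Perm ℕ := Equiv.swap 0 1 * (Equiv.swap 1 2 * Equiv.swap 2 3)

variable (α β γ : AffineDiagram N)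

/-- Three diagrams stacked on each other. -/
def glue₃ : Setoid (ℕ × ℤ) := (α.onRows 0 1 ⊔ β.onRows 1 2) ⊔ γ.onRows 2 3

theorem glue₃_eq : glue₃ α β γ = (β.onRows 1 2 ⊔ γ.onRows 2 3) ⊔ α.onRows 0 1 := by
  unfold glue₃; rw [sup_assoc, sup_comm]

theorem ncard_left (ess : Prop) : (bigComponents N (glue₃ α β γ) 1 2 ess).ncard =
    (components N (glue α β) 1 ess).ncard + (components N (glue (comp α β) γ) 1 ess).ncard := by
  rw [glue₃, ncard_bigComponents (D := (comp α β).onRows 0 2) (by norm_num)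
    (γ.isolated_onRows (by norm_num) (by norm_num))
    (comp_onRows (a := 0) (b := 1) (c := 2) (Equiv.refl ℕ) rfl rfl rfl)
    ((α.periodic_onRows _ _).sup (β.periodic_onRows _ _)) (γ.periodic_onRows _ _),
    components_rows (α := comp α β) (β := γ) perm023 (by decide) (by decide) (by decide)]
  rfl

theorem ncard_right (ess : Prop) : (bigComponents N (glue₃ α β γ) 1 2 ess).ncard =
    (components N (glue β γ) 1 ess).ncard + (components N (glue α (comp β γ)) 1 ess).ncard := by
  rw [bigComponents_comm, glue₃_eq, ncard_bigComponents (D := (comp β γ).onRows 1 3) (by norm_num)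
    (α.isolated_onRows (by norm_num) (by norm_num))
    (comp_onRows perm123 (by decide) (by decide) (by decide))
    ((β.periodic_onRows _ _).sup (γ.periodic_onRows _ _)) (α.periodic_onRows _ _),
    components_rows perm123 (by decide) (by decide) (by decide), sup_comm,
    components_rows (α := α) (β := comp β γ) perm013 (by decide) (by decide) (by decide)]

theorem loops_assoc : loops α β + loops (comp α β) γ = loops β γ + loops α (comp β γ) :=
  (ncard_left α β γ False).symm.trans (ncard_right α β γ False)

theorem newCircles_assoc :
    newCircles α β + newCircles (comp α β) γ = newCircles β γ + newCircles α (comp β γ) :=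
  (ncard_left α β γ True).symm.trans (ncard_right α β γ True)

theorem arcs_comp_left (x y : ℤ ⊕ ℤ) : (comp (comp α β) γ).arcs x y ↔
    glue₃ α β γ (place 0 3 x) (place 0 3 y) := by
  have hpl : ∀ x, place 0 3 x = (perm023 (place 0 2 x).1, (place 0 2 x).2) := by
    rintro (i | i)
    · exact Prod.ext (by decide : 0 = perm023 0) rfl
    · exact Prod.ext (by decide : 3 = perm023 2) rfl
  have h1 : ∀ x, (place 0 3 x).1 ≠ 1 := by rintro (i | i) <;> simp [place]
  rw [glue₃, sup_iff_of_hide (D := (comp α β).onRows 0 2)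
    (γ.isolated_onRows (by norm_num) (by norm_num))
    (comp_onRows (a := 0) (b := 1) (c := 2) (Equiv.refl ℕ) rfl rfl rfl) (h1 x) (h1 y), hpl, hpl,
    sup_rows_iff perm023 (by decide) (by decide) (by decide)]
  rfl

theorem arcs_comp_right (x y : ℤ ⊕ ℤ) : (comp α (comp β γ)).arcs x y ↔
    glue₃ α β γ (place 0 3 x) (place 0 3 y) := by
  have hpl : ∀ x, place 0 3 x = (perm013 (place 0 2 x).1, (place 0 2 x).2) := by
    rintro (i | i)
    · exact Prod.ext (by decide : 0 = perm013 0) rfl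
    · exact Prod.ext (by decide : 3 = perm013 2) rfl
  have h1 : ∀ x, (place 0 3 x).1 ≠ 2 := by rintro (i | i) <;> simp [place]
  rw [glue₃_eq, sup_iff_of_hide (D := (comp β γ).onRows 1 3)
    (α.isolated_onRows (by norm_num) (by norm_num))
    (comp_onRows perm123 (by decide) (by decide) (by decide)) (h1 x) (h1 y), sup_comm, hpl, hpl,
    sup_rows_iff perm013 (by decide) (by decide) (by decide)]
  rfl

theorem comp_assoc : comp (comp α β) γ = comp α (comp β γ) := by
  apply AffineDiagram.ext
  · ext x y
    rw [arcs_comp_left, arcs_comp_right]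
  · have := newCircles_assoc α β γ
    simp only [comp] at this ⊢
    omega

/-- The identity diagram: each top point is joined to the bottom point below it. -/
def one (N : ℕ) [NeZero N] : AffineDiagram N where
  arcs := Setoid.ker (Sum.elim id id)
  existsUnique_partner x := by
    refine ⟨x.swap, ⟨?_, ?_⟩, ?_⟩
    · rcases x with i | i <;> simp
    · rcases x with i | i <;> rfl
    · rintro y ⟨h1, h2⟩
      rcases x with i | i <;> rcases y with j | j <;> simp [Setoid.ker_def] at h1 h2 ⊢ <;> omega
  periodic x y := by
    rcases x with i | i <;> rcases y with j | j <;> simp [Setoid.ker_def, shift]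
  noncrossing a b c d := by
    rcases a with a | a <;> rcases b with b | b <;> rcases c with c | c <;> rcases d with d | d <;>
      simp [Setoid.ker_def, Before] <;> omega
  circles := 0
  circles_eq_zero _ _ _ := rfl

variable {α}

theorem glue_one_left {p q : ℕ × ℤ} (h : glue (one N) α p q) :
    α.onRows 1 2 (if p.1 = 0 then 1 else p.1, p.2) (if q.1 = 0 then 1 else q.1, q.2) := by
  have : glue (one N) α ≤ (α.onRows 1 2).comap (fun p => (if p.1 = 0 then 1 else p.1, p.2)) := by
    refine glue_le (fun x y hxy => ?_) (fun x y hxy => ?_)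
    · rw [Setoid.comap_rel]
      rcases x with i | i <;> rcases y with j | j <;> obtain rfl : i = j := hxy <;>
        exact Setoid.refl' _ _
    · rw [Setoid.comap_rel]
      have := onRows_of_arcs (r := 1) (s := 2) hxy
      rcases x with i | i <;> rcases y with j | j <;> exact this
  exact this h

theorem glue_one_right {p q : ℕ × ℤ} (h : glue α (one N) p q) :
    α.onRows 0 1 (if p.1 = 2 then 1 else p.1, p.2) (if q.1 = 2 then 1 else q.1, q.2) := by
  have : glue α (one N) ≤ (α.onRows 0 1).comap (fun p => (if p.1 = 2 then 1 else p.1, p.2)) := by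
    refine glue_le (fun x y hxy => ?_) (fun x y hxy => ?_)
    · rw [Setoid.comap_rel]
      have := onRows_of_arcs (r := 0) (s := 1) hxy
      rcases x with i | i <;> rcases y with j | j <;> exact this
    · rw [Setoid.comap_rel]
      rcases x with i | i <;> rcases y with j | j <;> obtain rfl : i = j := hxy <;>
        exact Setoid.refl' _ _
  exact this h

theorem components_one_left (ess : Prop) : components N (glue (one N) α) 1 ess = ∅ := by
  rw [Set.eq_empty_iff_forall_notMem]
  rintro C ⟨i, hi, -⟩
  have : glue (one N) α (1, i) (0, i) :=
    glue_of_left (onRows_of_arcs (x := Sum.inr i) (y := Sum.inl i) rfl)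
  exact absurd (hi _ this) (by norm_num)

theorem components_one_right (ess : Prop) : components N (glue α (one N)) 1 ess = ∅ := by
  rw [Set.eq_empty_iff_forall_notMem]
  rintro C ⟨i, hi, -⟩
  have : glue α (one N) (1, i) (2, i) :=
    glue_of_right (onRows_of_arcs (x := Sum.inl i) (y := Sum.inr i) rfl)
  exact absurd (hi _ this) (by norm_num)

theorem arcs_of_onRows {r s : ℕ} (h : r ≠ s) {x y} (hxy : α.onRows r s (place r s x) (place r s y)) :
    α.arcs x y := by
  have := Setoid.comap_map_eq (place r s) α.arcs (place_injective h)
  rw [← this]; exact hxy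

theorem one_comp : comp (one N) α = α := by
  apply AffineDiagram.ext
  · ext x y
    constructor
    · intro h
      have := glue_one_left h
      apply arcs_of_onRows (r := 1) (s := 2) (by norm_num)
      rcases x with i | i <;> rcases y with j | j <;> exact this
    · intro h
      have hx : ∀ x, glue (one N) α (place 0 2 x) (place 1 2 x) := by
        rintro (i | i)
        · exact glue_of_left (onRows_of_arcs (x := Sum.inl i) (y := Sum.inr i) rfl)
        · exact Setoid.refl' _ _
      exact Setoid.trans' (glue (one N) α) (hx x) (Setoid.trans' _
        (glue_of_right (onRows_of_arcs h)) (Setoid.symm' _ (hx y)))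
  · simp only [comp, newCircles, components_one_left, Set.ncard_empty]
    simp [one]

theorem comp_one : comp α (one N) = α := by
  apply AffineDiagram.ext
  · ext x y
    constructor
    · intro h
      have := glue_one_right h
      apply arcs_of_onRows (r := 0) (s := 1) (by norm_num)
      rcases x with i | i <;> rcases y with j | j <;> exact this
    · intro h
      have hx : ∀ x, glue α (one N) (place 0 2 x) (place 0 1 x) := by
        rintro (i | i)
        · exact Setoid.refl' _ _
        · exact glue_of_right (onRows_of_arcs (x := Sum.inr i) (y := Sum.inl i) rfl)
      exact Setoid.trans' (glue α (one N)) (hx x) (Setoid.trans' _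
        (glue_of_left (onRows_of_arcs h)) (Setoid.symm' _ (hx y)))
  · simp only [comp, newCircles, components_one_right, Set.ncard_empty]
    simp [one]

theorem loops_one_left : loops (one N) α = 0 := by simp [loops, components_one_left]

theorem loops_one_right : loops α (one N) = 0 := by simp [loops, components_one_right]

end AffineDiagram

/-! ### The algebra -/

open AffineDiagram

/-- The algebra `T_N(δ)`: the complex vector space with basis the affine diagrams, and product
`α β = δ ^ m(α, β) • (α ∘ β)`, see `TL.basis_mul_basis`. -/
def TL (N : ℕ) [NeZero N] (_δ : ℂ) : Type := AffineDiagram N →₀ ℂ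

namespace TL

variable {N : ℕ} [NeZero N] {δ : ℂ}

noncomputable instance : AddCommGroup (TL N δ) :=
  inferInstanceAs (AddCommGroup (AffineDiagram N →₀ ℂ))

noncomputable instance : Module ℂ (TL N δ) := inferInstanceAs (Module ℂ (AffineDiagram N →₀ ℂ))

/-- The basis of `T_N(δ)` formed by the affine diagrams. -/
noncomputable def basis (N : ℕ) [NeZero N] (δ : ℂ) : Module.Basis (AffineDiagram N) ℂ (TL N δ) :=
  Finsupp.basisSingleOne

/-- The bilinear product of `T_N(δ)`. -/
noncomputable def mulMap (N : ℕ) [NeZero N] (δ : ℂ) : TL N δ →ₗ[ℂ] TL N δ →ₗ[ℂ] TL N δ :=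
  (basis N δ).constr ℂ fun α => (basis N δ).constr ℂ fun β =>
    δ ^ loops α β • basis N δ (comp α β)

theorem mulMap_basis (α β : AffineDiagram N) :
    mulMap N δ (basis N δ α) (basis N δ β) = δ ^ loops α β • basis N δ (comp α β) := by
  rw [mulMap, Module.Basis.constr_basis, Module.Basis.constr_basis]

theorem mulMap_assoc (a b c : TL N δ) :
    mulMap N δ (mulMap N δ a b) c = mulMap N δ a (mulMap N δ b c) := by
  have hb := (basis N δ).mem_span
  induction hb a using Submodule.span_induction with
  | zero => simp
  | add x y _ _ hx hy => simp only [map_add, LinearMap.add_apply, hx, hy]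
  | smul r x _ hx => simp only [map_smul, LinearMap.smul_apply, hx]
  | mem x hx =>
  obtain ⟨α, rfl⟩ := hx
  induction hb b using Submodule.span_induction with
  | zero => simp
  | add x y _ _ hx hy => simp only [map_add, LinearMap.add_apply, hx, hy]
  | smul r x _ hx => simp only [map_smul, LinearMap.smul_apply, hx]
  | mem x hx =>
  obtain ⟨β, rfl⟩ := hx
  induction hb c using Submodule.span_induction with
  | zero => simp
  | add x y _ _ hx hy => simp only [map_add, hx, hy]
  | smul r x _ hx => simp only [map_smul, hx]
  | mem x hx =>
  obtain ⟨γ, rfl⟩ := hx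
  simp only [mulMap_basis, map_smul, LinearMap.smul_apply, smul_smul, ← pow_add, AffineDiagram.comp_assoc]
  rw [loops_assoc, add_comm]

theorem mulMap_one_left (a : TL N δ) : mulMap N δ (basis N δ (one N)) a = a := by
  have : mulMap N δ (basis N δ (one N)) = LinearMap.id := (basis N δ).ext fun α => by
    rw [mulMap_basis, loops_one_left, pow_zero, one_smul, one_comp, LinearMap.id_apply]
  rw [this, LinearMap.id_apply]

theorem mulMap_one_right (a : TL N δ) : mulMap N δ a (basis N δ (one N)) = a := by
  have : (mulMap N δ).flip (basis N δ (one N)) = LinearMap.id := (basis N δ).ext fun α => by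
    rw [LinearMap.flip_apply, mulMap_basis, loops_one_right, pow_zero, one_smul, comp_one,
      LinearMap.id_apply]
  rw [← LinearMap.flip_apply, this, LinearMap.id_apply]

noncomputable instance : Ring (TL N δ) :=
  { (inferInstance : AddCommGroup (TL N δ)) with
    mul := fun a b => mulMap N δ a b
    one := basis N δ (one N)
    mul_assoc := mulMap_assoc
    one_mul := mulMap_one_left
    mul_one := mulMap_one_right
    zero_mul := fun a => by change mulMap N δ 0 a = 0; simp
    mul_zero := fun a => by change mulMap N δ a 0 = 0; simp
    left_distrib := fun a b c => (mulMap N δ a).map_add b c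
    right_distrib := fun a b c => by
      change mulMap N δ (a + b) c = mulMap N δ a c + mulMap N δ b c
      simp }

noncomputable instance : Algebra ℂ (TL N δ) :=
  Algebra.ofModule (fun r a b => by
      change mulMap N δ (r • a) b = r • mulMap N δ a b
      simp)
    (fun r a b => (mulMap N δ a).map_smul r b)

theorem basis_mul_basis (α β : AffineDiagram N) :
    basis N δ α * basis N δ β = δ ^ loops α β • basis N δ (comp α β) := mulMap_basis α β

end TL

/-! ### Laurent polynomials -/

open LaurentPolynomial in
/-- The substitution `P(x) ↦ P(x ^ 3)` of Laurent polynomials. -/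
noncomputable def cubeSubst : ℂ[T;T⁻¹] →ₐ[ℂ] ℂ[T;T⁻¹] :=
  AddMonoidAlgebra.mapDomainAlgHom ℂ ℂ (AddMonoidHom.mulLeft (3 : ℤ))

open LaurentPolynomial in
theorem cubeSubst_T (n : ℤ) : cubeSubst (T n) = T (3 * n) := by
  simp only [cubeSubst, T]
  exact AddMonoidAlgebra.mapDomain_single

open LaurentPolynomial in
/-- The algebra of pairs `(S, T)` of complex Laurent polynomials such that `S(x) - T(x ^ 3)` is
divisible by `x ^ 2 + x ^ (-2) + δ`. -/
noncomputable def laurentPairs (δ : ℂ) : Subalgebra ℂ (ℂ[T;T⁻¹] × ℂ[T;T⁻¹]) where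
  carrier := {P | (T 2 + T (-2) + C δ : ℂ[T;T⁻¹]) ∣ P.1 - cubeSubst P.2}
  mul_mem' {P Q} hP hQ := by
    have h : (P * Q).1 - cubeSubst (P * Q).2 =
        (P.1 - cubeSubst P.2) * Q.1 + cubeSubst P.2 * (Q.1 - cubeSubst Q.2) := by
      rw [Prod.fst_mul, Prod.snd_mul, map_mul]; ring
    rw [Set.mem_ofPred_eq, h]
    exact dvd_add (hP.mul_right _) (hQ.mul_left _)
  add_mem' {P Q} hP hQ := by
    have h : (P + Q).1 - cubeSubst (P + Q).2 =
        (P.1 - cubeSubst P.2) + (Q.1 - cubeSubst Q.2) := by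
      rw [Prod.fst_add, Prod.snd_add, map_add]; ring
    rw [Set.mem_ofPred_eq, h]
    exact dvd_add hP hQ
  algebraMap_mem' r := by
    have h : (algebraMap ℂ (ℂ[T;T⁻¹] × ℂ[T;T⁻¹]) r).1 -
        cubeSubst (algebraMap ℂ (ℂ[T;T⁻¹] × ℂ[T;T⁻¹]) r).2 = 0 := by
      rw [Prod.algebraMap_apply, AlgHom.commutes, sub_self]
    rw [Set.mem_ofPred_eq, h]
    exact dvd_zero _

end AffineTL

/-! Write u for `rot δ 1`, e for `cc δ 0 0`, f = e + u⁻¹eu + ueu⁻¹ for `ccSum δ`, and q = x² + x⁻² +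
δ for `quad δ`. Since three is odd, some arc runs from top to bottom, so no circle goes around the
cylinder. Planarity then leaves two families of diagrams (`eq_rotation_or_capCup`): the rotations uⁿ
and the diagrams u⁻ⁱeuʲ with one through line, where (i, j) counts only up to adding the same
multiple of 3 to both entries.

If z commutes with u, its coefficient at u⁻ⁱeuʲ depends only on j - i. Hence z = A(u) + f B(u) with
unique Laurent polynomials A and B (`exists_of_comm_rot`, `rotHom_add_eq_zero`). Tracing arcs gives
e² = δe, eue = eu³ and eu⁻¹e = eu⁻³, and therefore ef = e q(u), fe = q(u) e and f² = q(u) f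
(`cc_mul_ccSum`, `ccSum_mul_cc`, `ccSum_mul_self`).

So ez = e C(u) and ze = C(u) e, where C = A + qB. The full turn u³ commutes with e, whereas a term
of C whose exponent is not divisible by 3 would show up in e C(u) but not in C(u) e. As u, u⁻¹ and e
generate the algebra, z is central exactly when A + qB = P(x³) for some P (`mem_center`,
`exists_of_mem_center`).

The pair attached to z is (A, P). Because f commutes with u and f² = q(u) f, both f ↦ 0 and f ↦ q
define homomorphisms on the elements A + fB, with values A and A + qB; this is why the product
becomes componentwise. The divisibility condition says that B exists, and q ≠ 0 makes B unique. The
map `toCenter` goes in the opposite direction, from (S, T) to S(u) + f B(u) with qB = T(x³) - S. -/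

namespace AffineTL

namespace AffineDiagram

/-! ### The diagrams with three marked points -/

/-- Two diagrams are equal if the arcs of the first are arcs of the second and some arc of the first
joins the top to the bottom. -/
theorem eq_of_arcs_le {N : ℕ} [NeZero N] {α γ : AffineDiagram N}
    (h : ∀ x y, γ.arcs x y → α.arcs x y) {i j : ℤ} (hij : γ.arcs (.inl i) (.inr j)) : α = γ := by
  have hp : ∀ x, α.partner x = γ.partner x := fun x =>
    (α.eq_partner (γ.partner_ne x) (h _ _ (γ.arcs_partner x))).symm
  apply AffineDiagram.ext
  · ext x y
    rw [α.arcs_iff, γ.arcs_iff, hp]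
  · rw [α.circles_eq_zero i j (h _ _ hij), γ.circles_eq_zero i j hij]

/-- The diagram in which the top point `k` is joined to the bottom point `k + n`. -/
def rotation (n : ℤ) : AffineDiagram 3 where
  arcs := Setoid.ker (Sum.elim (· + n) id)
  existsUnique_partner x := by
    rcases x with i | i
    · refine ⟨.inr (i + n), ⟨by simp, rfl⟩, ?_⟩
      rintro (j | j) ⟨h1, h2⟩ <;> simp [Setoid.ker_def] at h1 h2 ⊢ <;> omega
    · refine ⟨.inl (i - n), ⟨by simp, by simp [Setoid.ker_def]⟩, ?_⟩
      rintro (j | j) ⟨h1, h2⟩ <;> simp [Setoid.ker_def] at h1 h2 ⊢ <;> omega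
  periodic x y := by
    rcases x with i | i <;> rcases y with j | j <;> simp [Setoid.ker_def, shift] <;> omega
  noncrossing a b c d := by
    rcases a with a | a <;> rcases b with b | b <;> rcases c with c | c <;> rcases d with d | d <;>
      simp [Setoid.ker_def, Before] <;> omega
  circles := 0
  circles_eq_zero _ _ _ := rfl

/-- The label of a point in the diagram `capCup i j`: ends of an arc have the same label. -/
def capCupLabel (i j : ℤ) : ℤ ⊕ ℤ → ℤ
  -- Labels divisible by 3 mark through lines, labels congruent to 1 mark arcs at the top and labels
  -- congruent to 2 mark arcs at the bottom, so no unwanted coincidence occurs.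
  | .inl k => if (k - i) % 3 = 0 then k - i else 3 * ((k - i) / 3) + 1
  | .inr k => if (k - j) % 3 = 0 then k - j else 3 * ((k - j) / 3) + 2

/-- The diagram in which the top point `i` is joined to the bottom point `j`, and the two other
points of each boundary circle are joined to each other. -/
def capCup (i j : ℤ) : AffineDiagram 3 where
  arcs := Setoid.ker (capCupLabel i j)
  existsUnique_partner x := by
    simp only [Setoid.ker_def]
    rcases x with k | k
    -- Residue 0 is the end of a through line; residues 1 and 2 are the left and right ends of a
    -- short arc.
    · have h : (k - i) % 3 = 0 ∨ (k - i) % 3 = 1 ∨ (k - i) % 3 = 2 := by omega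
      rcases h with h | h | h
      · refine ⟨.inr (k - i + j), ⟨by simp, by simp [capCupLabel, h]⟩, ?_⟩
        rintro (l | l) ⟨h1, h2⟩ <;> simp [capCupLabel, h] at h1 h2 ⊢ <;> split_ifs at h2 <;> omega
      · refine ⟨.inl (k + 1), ⟨by simp, by simp only [capCupLabel]; split_ifs <;> omega⟩, ?_⟩
        rintro (l | l) ⟨h1, h2⟩ <;> simp [capCupLabel, h] at h1 h2 ⊢ <;> split_ifs at h2 <;> omega
      · refine ⟨.inl (k - 1), ⟨by simp, by simp only [capCupLabel]; split_ifs <;> omega⟩, ?_⟩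
        rintro (l | l) ⟨h1, h2⟩ <;> simp [capCupLabel, h] at h1 h2 ⊢ <;> split_ifs at h2 <;> omega
    · have h : (k - j) % 3 = 0 ∨ (k - j) % 3 = 1 ∨ (k - j) % 3 = 2 := by omega
      rcases h with h | h | h
      · refine ⟨.inl (k - j + i), ⟨by simp, by simp [capCupLabel, h]⟩, ?_⟩
        rintro (l | l) ⟨h1, h2⟩ <;> simp [capCupLabel, h] at h1 h2 ⊢ <;> split_ifs at h2 <;> omega
      · refine ⟨.inr (k + 1), ⟨by simp, by simp only [capCupLabel]; split_ifs <;> omega⟩, ?_⟩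
        rintro (l | l) ⟨h1, h2⟩ <;> simp [capCupLabel, h] at h1 h2 ⊢ <;> split_ifs at h2 <;> omega
      · refine ⟨.inr (k - 1), ⟨by simp, by simp only [capCupLabel]; split_ifs <;> omega⟩, ?_⟩
        rintro (l | l) ⟨h1, h2⟩ <;> simp [capCupLabel, h] at h1 h2 ⊢ <;> split_ifs at h2 <;> omega
  periodic x y := by
    rcases x with k | k <;> rcases y with l | l <;>
      simp only [Setoid.ker_def, shift, capCupLabel, Sum.map_inl, Sum.map_inr] <;> split_ifs <;>
      omega
  noncrossing a b c d := by
    rcases a with a | a <;> rcases b with b | b <;> rcases c with c | c <;> rcases d with d | d <;>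
      simp only [Setoid.ker_def, capCupLabel, Before] <;> intros <;> try contradiction
    all_goals split_ifs at * <;> omega
  circles := 0
  circles_eq_zero _ _ _ := rfl

theorem rotation_arcs {n : ℤ} {x y : ℤ ⊕ ℤ} :
    (rotation n).arcs x y ↔ Sum.elim (· + n) id x = Sum.elim (· + n) id y := Iff.rfl

theorem capCup_arcs {i j : ℤ} {x y : ℤ ⊕ ℤ} :
    (capCup i j).arcs x y ↔ capCupLabel i j x = capCupLabel i j y := Iff.rfl

theorem rotation_zero : rotation 0 = one 3 := by
  refine eq_of_arcs_le (i := 0) (j := 0) (fun x y h => ?_) rfl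
  have h' : Sum.elim id id x = Sum.elim id id y := h
  rw [rotation_arcs]
  rcases x with i | i <;> rcases y with j | j <;> simpa using h'

theorem rotation_inj {m n : ℤ} : rotation m = rotation n ↔ m = n := by
  refine ⟨fun h => ?_, fun h => h ▸ rfl⟩
  have h1 : (rotation n).arcs (.inl 0) (.inr m) := by
    rw [← h, rotation_arcs]; simp
  rw [rotation_arcs] at h1
  simpa using h1.symm

/-- The lifts of the through line of `capCup i j` join `i + 3c` to `j + 3c`. Hence only `i` modulo 3
and the difference `j - i` are determined by the diagram. -/
theorem capCup_inj {i j k l : ℤ} : capCup i j = capCup k l ↔ 3 ∣ k - i ∧ j - i = l - k := by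
  constructor
  · intro h
    have h1 : (capCup k l).arcs (.inl i) (.inr j) := by
      rw [← h, capCup_arcs]; simp [capCupLabel]
    rw [capCup_arcs] at h1
    simp only [capCupLabel] at h1
    split_ifs at h1 <;> omega
  · rintro ⟨h1, h2⟩
    refine eq_of_arcs_le (i := k) (j := l) (fun x y h => ?_) (by simp [capCup_arcs, capCupLabel])
    rw [capCup_arcs] at h ⊢
    rcases x with x | x <;> rcases y with y | y <;> simp only [capCupLabel] at h ⊢ <;>
      split_ifs at * <;> omega

theorem rotation_ne_capCup (n i j : ℤ) : rotation n ≠ capCup i j := by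
  intro h
  have h1 : (rotation n).arcs (.inl (i + 1)) (.inl (i + 2)) := by
    rw [h, capCup_arcs]; simp [capCupLabel]
  rw [rotation_arcs] at h1
  simp at h1

/-! ### Classification by planarity and periodicity -/

theorem arcs_unique {N : ℕ} [NeZero N] (α : AffineDiagram N) {x y z : ℤ ⊕ ℤ} (hy : α.arcs x y)
    (hz : α.arcs x z) (hyx : y ≠ x) (hzx : z ≠ x) : y = z :=
  (α.existsUnique_partner x).unique ⟨hyx, hy⟩ ⟨hzx, hz⟩

theorem arcs_shift_zsmul (α : AffineDiagram 3) {x y : ℤ ⊕ ℤ} (h : α.arcs x y) (k : ℤ) :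
    α.arcs (Sum.map (· + 3 * k) (· + 3 * k) x) (Sum.map (· + 3 * k) (· + 3 * k) y) := by
  induction k using Int.induction_on with
  | zero => rcases x with x | x <;> rcases y with y | y <;> simpa using h
  | succ k ih =>
    have := (α.periodic _ _).2 ih
    rcases x with x | x <;> rcases y with y | y <;>
      simpa [shift, mul_add, add_assoc] using this
  | pred k ih =>
    apply (α.periodic _ _).1
    rcases x with x | x <;> rcases y with y | y <;>
      simpa [shift, mul_sub, add_assoc] using ih

/-- A longer arc is impossible: if `b > a + 3` it crosses its own translate, if `b = a + 3` the
point `b` has two partners, and if `b = a + 2` the point `a + 1` is trapped under the arc with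
nobody to be joined to. -/
theorem arcs_inl_inl (α : AffineDiagram 3) {a b : ℤ} (h : α.arcs (.inl a) (.inl b)) (hab : a < b) :
    b = a + 1 := by
  have hs : α.arcs (.inl (a + 3)) (.inl (b + 3)) := (α.periodic (.inl a) (.inl b)).2 h
  have h3 : ¬ a + 3 < b := fun h3 =>
    α.noncrossing (.inl a) (.inl (a + 3)) (.inl b) (.inl (b + 3)) (by simp [Before])
      (by simpa [Before]) (by simp [Before]) h hs
  have h3' : b ≠ a + 3 := by
    rintro rfl
    have := α.arcs_unique (α.arcs.symm' h) hs (by simp) (by simp)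
    simp at this
    omega
  by_contra hne
  obtain rfl : b = a + 2 := by omega
  obtain ⟨c, hc⟩ : ∃ c, c = α.partner (.inl (a + 1)) := ⟨_, rfl⟩
  have hcn := α.partner_ne (.inl (a + 1))
  have hca := α.arcs_partner (.inl (a + 1))
  rw [← hc] at hcn hca
  have hc1 : c ≠ .inl a := by
    rintro rfl
    have := α.arcs_unique (α.arcs.symm' hca) h (by simp) (by simp)
    simp at this
  have hc2 : c ≠ .inl (a + 2) := by
    rintro rfl
    have := α.arcs_unique (α.arcs.symm' hca) (α.arcs.symm' h) (by simp) (by simp)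
    simp at this
  rcases c with c | c
  · simp only [ne_eq, Sum.inl.injEq] at hcn hc1 hc2
    rcases lt_or_ge c a with hlt | hge
    · exact α.noncrossing (.inl c) (.inl a) (.inl (a + 1)) (.inl (a + 2)) hlt (by simp [Before])
        (by simp [Before]) (α.arcs.symm' hca) h
    · exact α.noncrossing (.inl a) (.inl (a + 1)) (.inl (a + 2)) (.inl c) (by simp [Before])
        (by simp [Before]) (by simp only [Before]; omega) h hca
  · exact α.noncrossing (.inl a) (.inl (a + 1)) (.inl (a + 2)) (.inr c) (by simp [Before])
      (by simp [Before]) trivial h hca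

/-- Mirror image of `arcs_inl_inl`; the four points are listed backwards because `Before` runs along
the bottom line from right to left. -/
theorem arcs_inr_inr (α : AffineDiagram 3) {a b : ℤ} (h : α.arcs (.inr a) (.inr b)) (hab : a < b) :
    b = a + 1 := by
  have hs : α.arcs (.inr (a + 3)) (.inr (b + 3)) := (α.periodic (.inr a) (.inr b)).2 h
  have h3 : ¬ a + 3 < b := fun h3 =>
    α.noncrossing (.inr (b + 3)) (.inr b) (.inr (a + 3)) (.inr a) (by simp [Before])
      (by simpa [Before]) (by simp [Before]) (α.arcs.symm' hs) (α.arcs.symm' h)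
  have h3' : b ≠ a + 3 := by
    rintro rfl
    have := α.arcs_unique (α.arcs.symm' h) hs (by simp) (by simp)
    simp at this
    omega
  by_contra hne
  obtain rfl : b = a + 2 := by omega
  obtain ⟨c, hc⟩ : ∃ c, c = α.partner (.inr (a + 1)) := ⟨_, rfl⟩
  have hcn := α.partner_ne (.inr (a + 1))
  have hca := α.arcs_partner (.inr (a + 1))
  rw [← hc] at hcn hca
  have hc1 : c ≠ .inr a := by
    rintro rfl
    have := α.arcs_unique (α.arcs.symm' hca) h (by simp) (by simp)
    simp at this
  have hc2 : c ≠ .inr (a + 2) := by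
    rintro rfl
    have := α.arcs_unique (α.arcs.symm' hca) (α.arcs.symm' h) (by simp) (by simp)
    simp at this
  rcases c with c | c
  · exact α.noncrossing (.inl c) (.inr (a + 2)) (.inr (a + 1)) (.inr a) trivial (by simp [Before])
      (by simp [Before]) (α.arcs.symm' hca) (α.arcs.symm' h)
  · simp only [ne_eq, Sum.inr.injEq] at hcn hc1 hc2
    rcases lt_or_ge c a with hlt | hge
    · exact α.noncrossing (.inr (a + 2)) (.inr (a + 1)) (.inr a) (.inr c) (by simp [Before])
        (by simp [Before]) hlt (α.arcs.symm' h) hca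
    · exact α.noncrossing (.inr c) (.inr (a + 2)) (.inr (a + 1)) (.inr a)
        (by simp only [Before]; omega) (by simp [Before]) (by simp [Before]) (α.arcs.symm' hca)
        (α.arcs.symm' h)

/-- The translates of the given arc use up all top points outside the class of `i` modulo 3. So `i`
has to go down to some `j`, after which no top point is left for `j + 1`, which can only be joined
to `j + 2`. These three arcs and their translates are the whole diagram. -/
theorem eq_capCup (α : AffineDiagram 3) {i : ℤ} (h : α.arcs (.inl (i + 1)) (.inl (i + 2))) :
    ∃ j, α = capCup i j := by
  obtain ⟨j, hj⟩ : ∃ j, α.arcs (.inl i) (.inr j) := by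
    have hn := α.partner_ne (.inl i)
    have ha := α.arcs_partner (.inl i)
    rcases hp : α.partner (.inl i) with c | c <;> rw [hp] at hn ha
    · exfalso
      simp only [ne_eq, Sum.inl.injEq] at hn
      rcases lt_or_gt_of_ne hn with hlt | hlt
      -- The left neighbour of `i` is a translate of `i + 2`, hence already joined to the
      -- corresponding translate of `i + 1`.
      · obtain rfl := α.arcs_inl_inl (α.arcs.symm' ha) hlt
        have h' := α.arcs_shift_zsmul h (-1)
        have := α.arcs_unique (y := .inl (c + 1)) (z := .inl (c - 1)) (α.arcs.symm' ha)
          (by convert α.arcs.symm' h' using 1 <;> simp <;> omega) (by simp) (by simp)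
        simp at this
        omega
      · obtain rfl := α.arcs_inl_inl ha hlt
        have := α.arcs_unique (α.arcs.symm' ha) h (by simp) (by simp)
        simp at this
    · exact ⟨c, ha⟩
  have hb : α.arcs (.inr (j + 1)) (.inr (j + 2)) := by
    have hn := α.partner_ne (.inr (j + 1))
    have ha := α.arcs_partner (.inr (j + 1))
    rcases hp : α.partner (.inr (j + 1)) with c | c <;> rw [hp] at hn ha
    · exfalso
      -- Whatever its residue, the top point `c` is already an end of a translate of one of the two
      -- known arcs.
      have hk : (c - i) % 3 = 0 ∨ (c - i) % 3 = 1 ∨ (c - i) % 3 = 2 := by omega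
      rcases hk with hk | hk | hk
      · have h' := α.arcs_shift_zsmul hj ((c - i) / 3)
        have := α.arcs_unique (x := .inl c) (α.arcs.symm' ha)
          (by convert h' using 1; simp; omega) (by simp) (by simp)
        simp at this
        omega
      · have h' := α.arcs_shift_zsmul h ((c - i) / 3)
        have := α.arcs_unique (x := .inl c) (α.arcs.symm' ha)
          (by convert h' using 1; simp; omega) (by simp) (by simp; omega)
        simp at this
      · have h' := α.arcs_shift_zsmul (α.arcs.symm' h) ((c - i) / 3)
        have := α.arcs_unique (x := .inl c) (α.arcs.symm' ha)
          (by convert h' using 1; simp; omega) (by simp) (by simp; omega)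
        simp at this
    · simp only [ne_eq, Sum.inr.injEq] at hn
      rcases lt_or_gt_of_ne hn with hlt | hlt
      · obtain rfl : j = c := by have := α.arcs_inr_inr (α.arcs.symm' ha) hlt; omega
        have := α.arcs_unique (α.arcs.symm' ha) (α.arcs.symm' hj) (by simp) (by simp)
        simp at this
      · obtain rfl := α.arcs_inr_inr ha hlt
        simpa [add_assoc] using ha
  refine ⟨j, eq_of_arcs_le (i := i) (j := j) (fun x y hxy => ?_) (by simp [capCup_arcs, capCupLabel])⟩
  -- The order `Before x y` leaves three shapes: top to top, top to bottom, bottom to bottom. Each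
  -- is a translate of `h`, `hj` or the reverse of `hb`.
  have key : ∀ x y, capCupLabel i j x = capCupLabel i j y → x ≠ y → (Before x y) → α.arcs x y := by
    rintro (x | x) (y | y) hxy hne hB <;> simp only [Before, capCupLabel] at hxy hB
    · have h' := α.arcs_shift_zsmul h ((x - i) / 3)
      convert h' using 1 <;> simp <;> split_ifs at hxy <;> omega
    · have h' := α.arcs_shift_zsmul hj ((x - i) / 3)
      convert h' using 1 <;> simp <;> split_ifs at hxy <;> omega
    · have h' := α.arcs_shift_zsmul (α.arcs.symm' hb) ((x - j) / 3)
      convert h' using 1 <;> simp <;> split_ifs at hxy <;> omega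
  rw [capCup_arcs] at hxy
  by_cases hne : x = y
  · rw [hne]
  · by_cases hB : Before x y
    · exact key x y hxy hne hB
    · refine α.arcs.symm' (key y x hxy.symm (Ne.symm hne) ?_)
      rcases x with x | x <;> rcases y with y | y <;> simp [Before] at hB hne ⊢ <;> omega

/-- Every affine diagram with three marked points has three through lines or one. -/
theorem eq_rotation_or_capCup (α : AffineDiagram 3) :
    (∃ n, α = rotation n) ∨ ∃ i j, α = capCup i j := by
  by_cases hc : ∃ a b, a < b ∧ α.arcs (.inl a) (.inl b)
  · obtain ⟨a, b, hab, h⟩ := hc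
    obtain rfl := α.arcs_inl_inl h hab
    obtain ⟨j, hj⟩ := α.eq_capCup (i := a - 1) (by convert h using 2 <;> ring)
    exact Or.inr ⟨_, j, hj⟩
  left
  push Not at hc
  have hg : ∀ a, ∃ b, α.arcs (.inl a) (.inr b) := by
    intro a
    have hn := α.partner_ne (.inl a)
    have ha := α.arcs_partner (.inl a)
    rcases hp : α.partner (.inl a) with c | c <;> rw [hp] at hn ha
    · simp only [ne_eq, Sum.inl.injEq] at hn
      rcases lt_or_gt_of_ne hn with hlt | hlt
      · exact absurd (α.arcs.symm' ha) (hc _ _ hlt)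
      · exact absurd ha (hc _ _ hlt)
    · exact ⟨c, ha⟩
  choose g hg using hg
  -- With all top points going down, a descent of `g` would be a crossing and an equality would give
  -- a bottom point two partners.
  have hmono : ∀ a, g a < g (a + 1) := by
    intro a
    by_contra hle
    rcases lt_or_eq_of_le (not_lt.1 hle) with hlt | heq
    · exact α.noncrossing (.inl a) (.inl (a + 1)) (.inr (g a)) (.inr (g (a + 1))) (by simp [Before])
        trivial hlt (hg a) (hg (a + 1))
    · have h1 := hg (a + 1)
      rw [heq] at h1
      have := α.arcs_unique (α.arcs.symm' (hg a)) (α.arcs.symm' h1) (by simp) (by simp)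
      simp at this
  have hper : ∀ a, g (a + 3) = g a + 3 := by
    intro a
    have h1 : α.arcs (.inl (a + 3)) (.inr (g a + 3)) := (α.periodic (.inl a) (.inr (g a))).2 (hg a)
    have := α.arcs_unique (hg (a + 3)) h1 (by simp) (by simp)
    simpa using this
  -- Over one turn `g` grows by exactly 3 in three steps, each of size at least 1, so every step is
  -- 1.
  have hsucc : ∀ a, g (a + 1) = g a + 1 := by
    intro a
    have h1 := hmono a
    have h2 := hmono (a + 1)
    have h3 := hmono (a + 1 + 1)
    have h4 := hper a
    rw [show a + 1 + 1 + 1 = a + 3 by ring, h4] at h3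
    omega
  have hlin : ∀ a, g a = a + g 0 := by
    intro a
    induction a using Int.induction_on with
    | zero => simp
    | succ k ih => rw [hsucc, ih]; ring
    | pred k ih =>
      have := hsucc (-(k : ℤ) - 1)
      rw [sub_add_cancel, ih] at this
      omega
  refine ⟨g 0, eq_of_arcs_le (i := 0) (j := g 0) (fun x y hxy => ?_) (by simp [rotation_arcs])⟩
  rw [rotation_arcs] at hxy
  rcases x with x | x <;> rcases y with y | y <;> simp at hxy
  · rw [hxy]
  · rw [← hxy, ← hlin]; exact hg x
  · rw [hxy, ← hlin]; exact α.arcs.symm' (hg y)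
  · rw [hxy]

/-! ### Products of diagrams -/

/-- A diagram with a through line is determined by its arcs and has no circles, so it is enough to
exhibit the arcs of the expected product; the components of the glued picture need not be
classified. -/
theorem comp_eq {N : ℕ} [NeZero N] {α β γ : AffineDiagram N}
    (h : ∀ x y, γ.arcs x y → glue α β (place 0 2 x) (place 0 2 y)) {i j : ℤ}
    (hij : γ.arcs (.inl i) (.inr j)) : comp α β = γ := eq_of_arcs_le h hij

theorem glue_rotation_left (n : ℤ) (β : AffineDiagram 3) (k : ℤ) :
    glue (rotation n) β (0, k) (1, k + n) :=
  glue_of_left (onRows_of_arcs (x := .inl k) (y := .inr (k + n)) rfl)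

theorem glue_rotation_right (n : ℤ) (β : AffineDiagram 3) (k : ℤ) :
    glue β (rotation n) (1, k) (2, k + n) :=
  glue_of_right (onRows_of_arcs (x := .inl k) (y := .inr (k + n)) rfl)

theorem rotation_comp {n : ℤ} {β γ : AffineDiagram 3}
    (h : ∀ x y, γ.arcs x y → β.arcs (Sum.map (· + n) id x) (Sum.map (· + n) id y)) {i j : ℤ}
    (hij : γ.arcs (.inl i) (.inr j)) : comp (rotation n) β = γ := by
  refine comp_eq (fun x y hxy => ?_) hij
  have hx : ∀ x, glue (rotation n) β (place 0 2 x) (place 1 2 (Sum.map (· + n) id x)) := by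
    rintro (x | x)
    · exact glue_rotation_left n β x
    · exact Setoid.refl' _ _
  exact Setoid.trans' _ (hx x) (Setoid.trans' _ (glue_of_right (onRows_of_arcs (h x y hxy)))
    (Setoid.symm' _ (hx y)))

theorem comp_rotation {n : ℤ} {β γ : AffineDiagram 3}
    (h : ∀ x y, γ.arcs x y → β.arcs (Sum.map id (· - n) x) (Sum.map id (· - n) y)) {i j : ℤ}
    (hij : γ.arcs (.inl i) (.inr j)) : comp β (rotation n) = γ := by
  refine comp_eq (fun x y hxy => ?_) hij
  have hx : ∀ x, glue β (rotation n) (place 0 2 x) (place 0 1 (Sum.map id (· - n) x)) := by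
    rintro (x | x)
    · exact Setoid.refl' _ _
    · have := glue_rotation_right n β (x - n)
      rw [sub_add_cancel] at this
      exact Setoid.symm' _ this
  exact Setoid.trans' _ (hx x) (Setoid.trans' _ (glue_of_left (onRows_of_arcs (h x y hxy)))
    (Setoid.symm' _ (hx y)))

/-- A loop stays on the middle line, so it cannot pass through a middle point that is connected to
an outer line. -/
theorem loops_eq_zero {N : ℕ} [NeZero N] {α β : AffineDiagram N}
    (h : ∀ i, ∃ p : ℕ × ℤ, glue α β (1, i) p ∧ p.1 ≠ 1) : loops α β = 0 := by
  unfold loops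
  rw [Set.ncard_eq_zero ((components_finite (periodic_glue α β) 1 False)),
    Set.eq_empty_iff_forall_notMem]
  rintro C ⟨i, hi, -⟩
  obtain ⟨p, hp, hp1⟩ := h i
  exact hp1 (hi p hp)

theorem loops_rotation_left (n : ℤ) (β : AffineDiagram 3) : loops (rotation n) β = 0 :=
  loops_eq_zero fun i => ⟨(0, i - n), Setoid.symm' _ (by
    have := glue_rotation_left n β (i - n)
    rwa [sub_add_cancel] at this), by simp⟩

theorem loops_rotation_right (n : ℤ) (β : AffineDiagram 3) : loops β (rotation n) = 0 :=
  loops_eq_zero fun i => ⟨(2, i + n), glue_rotation_right n β i, by simp⟩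

theorem rotation_comp_rotation (m n : ℤ) : comp (rotation m) (rotation n) = rotation (m + n) := by
  refine rotation_comp (i := 0) (j := m + n) (fun x y h => ?_) (by simp [rotation_arcs])
  rw [rotation_arcs] at h ⊢
  rcases x with x | x <;> rcases y with y | y <;> simp at h ⊢ <;> omega

theorem rotation_comp_capCup (n i j : ℤ) : comp (rotation n) (capCup i j) = capCup (i - n) j := by
  refine rotation_comp (i := i - n) (j := j) (fun x y h => ?_) (by simp [capCup_arcs, capCupLabel])
  have hx : ∀ x, capCupLabel i j (Sum.map (· + n) id x) = capCupLabel (i - n) j x := by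
    rintro (x | x) <;> simp [capCupLabel, sub_sub_eq_add_sub]
  rw [capCup_arcs, hx, hx]
  exact h

theorem capCup_comp_rotation (n i j : ℤ) : comp (capCup i j) (rotation n) = capCup i (j + n) := by
  refine comp_rotation (i := i) (j := j + n) (fun x y h => ?_) (by simp [capCup_arcs, capCupLabel])
  have hx : ∀ x, capCupLabel i j (Sum.map id (· - n) x) = capCupLabel i (j + n) x := by
    rintro (x | x) <;> simp [capCupLabel, sub_sub, add_comm]
  rw [capCup_arcs, hx, hx]
  exact h

/-! ### Products of two diagrams with one through line -/

/-- The upper short arcs of the product are those of `α` and the lower ones those of `β`; the latter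
fit `capCup i m` because `m` and `l` agree modulo 3. Only the through lines have to be traced, which
is the hypothesis `hm`. -/
theorem glue_capCup_comp {α β : AffineDiagram 3} {i j k l m : ℤ} (hα : α = capCup i j)
    (hβ : β = capCup k l) (hm : ∀ c, glue α β (0, i + 3 * c) (2, m + 3 * c))
    (hml : 3 ∣ m - l) : comp α β = capCup i m := by
  refine comp_eq (i := i) (j := m) (fun x y h => ?_) (by simp [capCup_arcs, capCupLabel])
  have h' := capCup_arcs.1 h
  rcases x with x | x <;> rcases y with y | y <;> simp only [capCupLabel] at h'
  · refine glue_of_left (onRows_of_arcs (x := .inl x) (y := .inl y) ?_)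
    rw [hα]
    exact h
  · have := hm ((x - i) / 3)
    convert this using 1 <;> simp [place] <;> split_ifs at h' <;> omega
  · have := Setoid.symm' _ (hm ((y - i) / 3))
    convert this using 1 <;> simp [place] <;> split_ifs at h' <;> omega
  · refine glue_of_right (onRows_of_arcs (x := .inr x) (y := .inr y) ?_)
    rw [hβ, capCup_arcs]
    simp only [capCupLabel]
    split_ifs at h' ⊢ <;> omega

theorem glue_capCup_left {i j : ℤ} (β : AffineDiagram 3) (x y : ℤ ⊕ ℤ)
    (h : capCupLabel i j x = capCupLabel i j y) :
    glue (capCup i j) β (place 0 1 x) (place 0 1 y) :=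
  glue_of_left (onRows_of_arcs h)

theorem glue_capCup_right {i j : ℤ} (α : AffineDiagram 3) (x y : ℤ ⊕ ℤ)
    (h : capCupLabel i j x = capCupLabel i j y) :
    glue α (capCup i j) (place 1 2 x) (place 1 2 y) :=
  glue_of_right (onRows_of_arcs h)

theorem capCup_comp_self : comp (capCup 0 0) (capCup 0 0) = capCup 0 0 := by
  refine glue_capCup_comp rfl rfl (fun c => ?_) (by simp)
  have h1 := glue_capCup_left (i := 0) (j := 0) (capCup 0 0) (.inl (0 + 3 * c)) (.inr (3 * c))
    (by simp [capCupLabel])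
  have h2 := glue_capCup_right (i := 0) (j := 0) (capCup 0 0) (.inl (3 * c)) (.inr (0 + 3 * c))
    (by simp [capCupLabel])
  exact Setoid.trans' _ h1 h2

/-- The through line enters the middle at `3c + 1` and zigzags through all three middle points of a
period before it leaves one full turn further on. This yields both the product and the absence of
loops. -/
theorem glue_capCup_one (c : ℤ) :
    glue (capCup 0 1) (capCup 0 0) (0, 3 * c) (1, 3 * c + 1) ∧
    glue (capCup 0 1) (capCup 0 0) (1, 3 * c + 1) (1, 3 * c + 2) ∧
    glue (capCup 0 1) (capCup 0 0) (1, 3 * c + 2) (1, 3 * c + 3) ∧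
    glue (capCup 0 1) (capCup 0 0) (1, 3 * c + 3) (2, 3 * c + 3) := by
  refine ⟨glue_capCup_left _ (.inl (3 * c)) (.inr (3 * c + 1)) ?_,
    glue_capCup_right _ (.inl (3 * c + 1)) (.inl (3 * c + 2)) ?_,
    glue_capCup_left _ (.inr (3 * c + 2)) (.inr (3 * c + 3)) ?_,
    glue_capCup_right _ (.inl (3 * c + 3)) (.inr (3 * c + 3)) ?_⟩ <;>
  simp only [capCupLabel] <;> split_ifs <;> omega

/-- The same zigzag run to the left, ending one full turn back. -/
theorem glue_capCup_neg_one (c : ℤ) :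
    glue (capCup 0 (-1)) (capCup 0 0) (0, 3 * c) (1, 3 * c - 1) ∧
    glue (capCup 0 (-1)) (capCup 0 0) (1, 3 * c - 1) (1, 3 * c - 2) ∧
    glue (capCup 0 (-1)) (capCup 0 0) (1, 3 * c - 2) (1, 3 * c - 3) ∧
    glue (capCup 0 (-1)) (capCup 0 0) (1, 3 * c - 3) (2, 3 * c - 3) := by
  refine ⟨glue_capCup_left _ (.inl (3 * c)) (.inr (3 * c - 1)) ?_,
    glue_capCup_right _ (.inl (3 * c - 1)) (.inl (3 * c - 2)) ?_,
    glue_capCup_left _ (.inr (3 * c - 2)) (.inr (3 * c - 3)) ?_,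
    glue_capCup_right _ (.inl (3 * c - 3)) (.inr (3 * c - 3)) ?_⟩ <;>
  simp only [capCupLabel] <;> split_ifs <;> omega

theorem capCup_comp_one : comp (capCup 0 1) (capCup 0 0) = capCup 0 3 := by
  refine glue_capCup_comp rfl rfl (fun c => ?_) (by simp)
  obtain ⟨h1, h2, h3, h4⟩ := glue_capCup_one c
  rw [zero_add, add_comm 3]
  exact Setoid.trans' _ h1 (Setoid.trans' _ h2 (Setoid.trans' _ h3 h4))

theorem capCup_comp_neg_one : comp (capCup 0 (-1)) (capCup 0 0) = capCup 0 (-3) := by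
  refine glue_capCup_comp rfl rfl (fun c => ?_) (by simp)
  obtain ⟨h1, h2, h3, h4⟩ := glue_capCup_neg_one c
  rw [zero_add, add_comm (-3), ← sub_eq_add_neg]
  exact Setoid.trans' _ h1 (Setoid.trans' _ h2 (Setoid.trans' _ h3 h4))

theorem loops_capCup_one : loops (capCup 0 1) (capCup 0 0) = 0 := by
  -- The integer `c = (i - 1) / 3` is the one for which `i` lies among the middle points `3c + 1`,
  -- `3c + 2`, `3c + 3` of the zigzag.
  refine loops_eq_zero fun i => ⟨(2, 3 * ((i - 1) / 3) + 3), ?_, by simp⟩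
  obtain ⟨h1, h2, h3, h4⟩ := glue_capCup_one ((i - 1) / 3)
  have hi : i = 3 * ((i - 1) / 3) + 1 ∨ i = 3 * ((i - 1) / 3) + 2 ∨ i = 3 * ((i - 1) / 3) + 3 := by
    omega
  have h3' := Setoid.trans' _ h3 h4
  have h2' := Setoid.trans' _ h2 h3'
  generalize (i - 1) / 3 = c at *
  rcases hi with rfl | rfl | rfl <;> assumption

theorem loops_capCup_neg_one : loops (capCup 0 (-1)) (capCup 0 0) = 0 := by
  -- Here the middle points of the zigzag are `3c - 1`, `3c - 2`, `3c - 3`, so `c = i / 3 + 1`.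
  refine loops_eq_zero fun i => ⟨(2, 3 * (i / 3 + 1) - 3), ?_, by simp⟩
  obtain ⟨h1, h2, h3, h4⟩ := glue_capCup_neg_one (i / 3 + 1)
  have hi : i = 3 * (i / 3 + 1) - 1 ∨ i = 3 * (i / 3 + 1) - 2 ∨ i = 3 * (i / 3 + 1) - 3 := by
    omega
  have h3' := Setoid.trans' _ h3 h4
  have h2' := Setoid.trans' _ h2 h3'
  generalize i / 3 + 1 = c at *
  rcases hi with rfl | rfl | rfl <;> assumption

/-- Labels of the components of `capCup 0 0` glued to itself. -/
theorem glue_capCup_self_le : glue (capCup 0 0) (capCup 0 0) ≤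
    -- The value 3 stands for the through lines, as 0, 1 and 2 number the glued lines. All other
    -- points keep their line number, because their arcs never leave the line.
    Setoid.ker (fun p : ℕ × ℤ => (if p.2 % 3 = 0 then 3 else p.1, p.2 / 3)) := by
  refine glue_le ?_ ?_ <;>
  · intro x y h
    rw [capCup_arcs] at h
    rw [Setoid.ker_def, Prod.mk.injEq]
    rcases x with x | x <;> rcases y with y | y <;>
      simp only [capCupLabel, place, sub_zero] at h ⊢ <;> split_ifs at h with hx hy hy <;>
      first | (exfalso; omega) | (refine ⟨?_, by omega⟩; simp only [hx, hy, if_true, if_false])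

/-- The bottom arc of the upper copy and the top arc of the lower copy both join `3c + 1` to `3c +
2` and close up. The lifts for different `c` are the same loop on the cylinder, and they are
pairwise disconnected in the strip, so this loop is contractible. -/
theorem loops_capCup_self : loops (capCup 0 0) (capCup 0 0) = 1 := by
  unfold loops
  rw [Set.ncard_eq_one]
  have hab : ∀ c : ℤ, glue (capCup 0 0) (capCup 0 0) (1, 3 * c + 1) (1, 3 * c + 2) := fun c =>
    glue_capCup_left _ (.inr (3 * c + 1)) (.inr (3 * c + 2))
      (by simp only [capCupLabel]; split_ifs <;> omega)
  have h12 : ∀ i j : ℤ, i % 3 ≠ 0 → j % 3 ≠ 0 → i / 3 = j / 3 →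
      glue (capCup 0 0) (capCup 0 0) (1, i) (1, j) := by
    intro i j hi hj hij
    have h := hab (i / 3)
    have hi' : i = 3 * (i / 3) + 1 ∨ i = 3 * (i / 3) + 2 := by omega
    have hj' : j = 3 * (i / 3) + 1 ∨ j = 3 * (i / 3) + 2 := by omega
    generalize i / 3 = c at *
    rcases hi' with rfl | rfl <;> rcases hj' with rfl | rfl
    · exact Setoid.refl' _ _
    · exact h
    · exact Setoid.symm' _ h
    · exact Setoid.refl' _ _
  have hcl : ∀ (i : ℤ) (p : ℕ × ℤ), glue (capCup 0 0) (capCup 0 0) (1, i) p → i % 3 ≠ 0 →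
      (p.1 = 1 ∨ p.1 = 3) ∧ p.2 / 3 = i / 3 ∧ (p.1 = 1 → p.2 % 3 ≠ 0) := by
    intro i p hp hi
    have h := glue_capCup_self_le hp
    rw [Setoid.ker_def, Prod.mk.injEq] at h
    simp only [if_neg hi] at h
    have := h.1
    split_ifs at this <;> omega
  -- All middle points off the through lines give the same set of lifts, so there is at most one
  -- loop.
  have hclass : ∀ i : ℤ, i % 3 ≠ 0 →
      {j : ℤ | ∃ k : ℤ, glue (capCup 0 0) (capCup 0 0) (1, i) (1, j + k * (3 : ℕ))} =
        {j | j % 3 ≠ 0} := by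
    intro i hi
    ext j
    constructor
    · rintro ⟨k, hk⟩
      have := (hcl _ _ hk hi).2.2 rfl
      simp only [Nat.cast_ofNat] at this
      change j % 3 ≠ 0
      omega
    · intro hj
      change j % 3 ≠ 0 at hj
      refine ⟨i / 3 - j / 3, h12 _ _ hi ?_ ?_⟩ <;> push_cast <;> omega
  refine ⟨{j | j % 3 ≠ 0}, ?_⟩
  ext C
  rw [Set.mem_singleton_iff]
  constructor
  · rintro ⟨i, hi, -, rfl⟩
    refine hclass i fun h0 => ?_
    have := hi _ (glue_capCup_right (capCup 0 0) (.inl i) (.inr i) (by simp [capCupLabel, h0]))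
    simp [place] at this
  · rintro rfl
    refine ⟨1, fun p hp => ?_, ?_, (hclass 1 (by norm_num)).symm⟩
    · have h := glue_row hp (by norm_num)
      have := (hcl 1 p hp (by norm_num)).1
      omega
    -- A translate by `k ≠ 0` turns would have another value of `p.2 / 3`, which is constant on
    -- components.
    · refine iff_false_intro ?_
      rintro ⟨k, hk, h⟩
      have := (hcl 1 _ h (by norm_num)).2.1
      simp only [Nat.cast_ofNat] at this
      omega

end AffineDiagram
end AffineTL
namespace AffineTL

open AffineDiagram LaurentPolynomial

namespace TL

/-! ### Generators and relations of `T_3(δ)` -/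

variable {δ : ℂ}

/-- The basis element of a diagram with three through lines. -/
noncomputable def rot (δ : ℂ) (n : ℤ) : TL 3 δ := basis 3 δ (rotation n)

/-- The basis element of a diagram with one through line. -/
noncomputable def cc (δ : ℂ) (i j : ℤ) : TL 3 δ := basis 3 δ (capCup i j)

theorem rot_zero : rot δ 0 = 1 := by rw [rot, rotation_zero]; rfl

theorem rot_mul_rot (m n : ℤ) : rot δ m * rot δ n = rot δ (m + n) := by
  rw [rot, rot, basis_mul_basis, loops_rotation_left, rotation_comp_rotation, pow_zero, one_smul]
  rfl

theorem rot_mul_cc (n i j : ℤ) : rot δ n * cc δ i j = cc δ (i - n) j := by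
  rw [rot, cc, basis_mul_basis, loops_rotation_left, rotation_comp_capCup, pow_zero, one_smul]
  rfl

theorem cc_mul_rot (n i j : ℤ) : cc δ i j * rot δ n = cc δ i (j + n) := by
  rw [rot, cc, basis_mul_basis, loops_rotation_right, capCup_comp_rotation, pow_zero, one_smul]
  rfl

theorem cc_congr {i j k l : ℤ} (h : 3 ∣ k - i) (h' : j - i = l - k) : cc δ i j = cc δ k l := by
  rw [cc, cc, capCup_inj.2 ⟨h, h'⟩]

theorem cc_mul_self : cc δ 0 0 * cc δ 0 0 = δ • cc δ 0 0 := by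
  rw [cc, basis_mul_basis, loops_capCup_self, capCup_comp_self, pow_one]

/-- This is the relation eue = eu³, since `cc δ 0 j` is euʲ. -/
theorem cc_one_mul : cc δ 0 1 * cc δ 0 0 = cc δ 0 3 := by
  rw [cc, cc, basis_mul_basis, loops_capCup_one, capCup_comp_one, pow_zero, one_smul]
  rfl

theorem cc_neg_one_mul : cc δ 0 (-1) * cc δ 0 0 = cc δ 0 (-3) := by
  rw [cc, cc, basis_mul_basis, loops_capCup_neg_one, capCup_comp_neg_one, pow_zero, one_smul]
  rfl

/-- Together with the rotations, the single element `cc δ 0 0` generates the algebra; identities and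
commutation are checked on it alone. -/
theorem cc_eq (i j : ℤ) : cc δ i j = rot δ (-i) * (cc δ 0 0 * rot δ j) := by
  rw [cc_mul_rot, rot_mul_cc]
  simp

/-- The subalgebra generated by the rotations. -/
noncomputable def rotHom (δ : ℂ) : ℂ[T;T⁻¹] →ₐ[ℂ] TL 3 δ :=
  AddMonoidAlgebra.lift ℂ (TL 3 δ) ℤ
    { toFun := fun n => rot δ n.toAdd
      map_one' := rot_zero
      map_mul' := fun m n => (rot_mul_rot m.toAdd n.toAdd).symm }

theorem rotHom_T (n : ℤ) : rotHom δ (T n) = rot δ n := by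
  rw [rotHom, T, AddMonoidAlgebra.lift_single, one_smul]
  rfl

theorem laurent_hom_ext {M : Type*} [AddCommMonoid M] [Module ℂ M] {f g : ℂ[T;T⁻¹] →ₗ[ℂ] M}
    (h : ∀ n, f (T n) = g (T n)) : f = g := by
  refine LinearMap.ext fun p => ?_
  induction p using LaurentPolynomial.induction_on' with
  | add p q hp hq => rw [map_add, map_add, hp, hq]
  | C_mul_T n a => rw [← smul_eq_C_mul, map_smul, map_smul, h]

/-- The polynomial `x ^ 2 + x ^ (-2) + δ`. -/
noncomputable def quad (δ : ℂ) : ℂ[T;T⁻¹] := T 2 + T (-2) + C δ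

/-- The coefficient of x² is 1 for every δ. This allows cancelling `quad δ`, on which the uniqueness
of the quotient rests. -/
theorem quad_ne_zero : quad δ ≠ 0 := by
  intro h
  have := congrArg (fun p => AddMonoidAlgebra.coeff p 2) h
  simp [quad] at this

theorem rotHom_quad : rotHom δ (quad δ) = rot δ 2 + rot δ (-2) + algebraMap ℂ _ δ := by
  rw [quad, map_add, map_add, rotHom_T, rotHom_T, C_eq_algebraMap, AlgHom.commutes]

/-- The sum of the diagrams with one through line that are conjugate to `cc δ 0 0`. -/
noncomputable def ccSum (δ : ℂ) : TL 3 δ := cc δ 0 0 + cc δ 1 1 + cc δ (-1) (-1)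

/-- Since `cc δ i i` is u⁻ⁱeuⁱ and depends only on `i` modulo 3, conjugation by a rotation permutes
the three summands cyclically. -/
theorem ccSum_comm_rot (n : ℤ) : ccSum δ * rot δ n = rot δ n * ccSum δ := by
  simp only [ccSum, add_mul, mul_add, cc_mul_rot, rot_mul_cc]
  have hn : n % 3 = 0 ∨ n % 3 = 1 ∨ n % 3 = 2 := by omega
  rcases hn with hn | hn | hn
  · rw [cc_congr (i := 0 - n) (k := 0) (l := 0 + n), cc_congr (i := 1 - n) (k := 1) (l := 1 + n),
      cc_congr (i := -1 - n) (k := -1) (l := -1 + n)] <;> omega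
  · rw [cc_congr (i := 0 - n) (k := -1) (l := -1 + n), cc_congr (i := 1 - n) (k := 0) (l := 0 + n),
      cc_congr (i := -1 - n) (k := 1) (l := 1 + n)]
    · abel
    all_goals omega
  · rw [cc_congr (i := 0 - n) (k := 1) (l := 1 + n), cc_congr (i := 1 - n) (k := -1) (l := -1 + n),
      cc_congr (i := -1 - n) (k := 0) (l := 0 + n)]
    · abel
    all_goals omega

theorem ccSum_comm (A : ℂ[T;T⁻¹]) : ccSum δ * rotHom δ A = rotHom δ A * ccSum δ := by
  have : LinearMap.mulLeft ℂ (ccSum δ) ∘ₗ (rotHom δ).toLinearMap =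
      LinearMap.mulRight ℂ (ccSum δ) ∘ₗ (rotHom δ).toLinearMap :=
    laurent_hom_ext fun n => by
      simpa [rotHom_T] using ccSum_comm_rot n
  exact LinearMap.congr_fun this A

/-- The three summands contribute e² = δe, eu⁻¹eu = eu⁻³u = eu⁻² and eueu⁻¹ = eu³u⁻¹ = eu². This is
the origin of the polynomial x² + x⁻² + δ. -/
theorem cc_mul_ccSum : cc δ 0 0 * ccSum δ = cc δ 0 0 * rotHom δ (quad δ) := by
  have h1 : cc δ 0 0 * cc δ 1 1 = cc δ 0 (-2) := by
    rw [cc_eq 1 1, ← mul_assoc, ← mul_assoc, cc_mul_rot, zero_add, cc_neg_one_mul, cc_mul_rot]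
    rfl
  have h2 : cc δ 0 0 * cc δ (-1) (-1) = cc δ 0 2 := by
    rw [cc_eq (-1) (-1), ← mul_assoc, ← mul_assoc, cc_mul_rot, zero_add, neg_neg, cc_one_mul,
      cc_mul_rot]
    rfl
  rw [rotHom_quad, ccSum, mul_add, mul_add, mul_add, mul_add, cc_mul_self, h1, h2, cc_mul_rot,
    cc_mul_rot, zero_add, zero_add, ← Algebra.commutes, ← Algebra.smul_def]
  abel

theorem ccSum_mul_cc : ccSum δ * cc δ 0 0 = rotHom δ (quad δ) * cc δ 0 0 := by
  have h1 : cc δ 1 1 * cc δ 0 0 = cc δ (-2) 0 := by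
    rw [cc_eq 1 1, mul_assoc, cc_mul_rot, zero_add, cc_one_mul, rot_mul_cc]
    -- The factor u³ produced on the right of e is carried to its left: u⁻¹eu³ = u²e.
    exact cc_congr (by norm_num) (by norm_num)
  have h2 : cc δ (-1) (-1) * cc δ 0 0 = cc δ 2 0 := by
    rw [cc_eq (-1) (-1), mul_assoc, cc_mul_rot, zero_add, cc_neg_one_mul, rot_mul_cc]
    exact cc_congr (by norm_num) (by norm_num)
  rw [rotHom_quad, ccSum, add_mul, add_mul, add_mul, add_mul, cc_mul_self, h1, h2, rot_mul_cc,
    rot_mul_cc, zero_sub, zero_sub, neg_neg, ← Algebra.smul_def]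
  abel

/-- As f and q(u) both commute with rotations, the identity fe = q(u) e passes to u⁻ⁱeuʲ. -/
theorem ccSum_mul_cc' (i j : ℤ) : ccSum δ * cc δ i j = rotHom δ (quad δ) * cc δ i j := by
  rw [cc_eq, ← mul_assoc, ccSum_comm_rot, mul_assoc, ← mul_assoc (ccSum δ), ccSum_mul_cc,
    ← mul_assoc, ← mul_assoc, ← mul_assoc, ← mul_assoc, ← rotHom_T, ← map_mul, ← map_mul, mul_comm]

theorem ccSum_mul_self : ccSum δ * ccSum δ = rotHom δ (quad δ) * ccSum δ := by
  have h : ccSum δ = cc δ 0 0 + cc δ 1 1 + cc δ (-1) (-1) := rfl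
  calc ccSum δ * ccSum δ = ccSum δ * (cc δ 0 0 + cc δ 1 1 + cc δ (-1) (-1)) := by rw [← h]
    _ = rotHom δ (quad δ) * (cc δ 0 0 + cc δ 1 1 + cc δ (-1) (-1)) := by
      simp only [mul_add, ccSum_mul_cc']

/-! ### Coefficients -/

/-- The coefficient of a diagram. -/
noncomputable def coord (δ : ℂ) (α : AffineDiagram 3) : TL 3 δ →ₗ[ℂ] ℂ := (basis 3 δ).coord α

open Classical in
theorem coord_basis (α β : AffineDiagram 3) :
    coord δ α (basis 3 δ β) = if β = α then 1 else 0 := by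
  rw [coord, Module.Basis.coord_apply, Module.Basis.repr_self, Finsupp.single_apply]

theorem coord_rot_rot (m n : ℤ) : coord δ (rotation m) (rot δ n) = if n = m then 1 else 0 := by
  simp only [rot, coord_basis, rotation_inj]

theorem coord_rot_cc (m i j : ℤ) : coord δ (rotation m) (cc δ i j) = 0 := by
  rw [cc, coord_basis, if_neg (rotation_ne_capCup _ _ _).symm]

theorem coord_cc_rot (m i j : ℤ) : coord δ (capCup i j) (rot δ m) = 0 := by
  rw [rot, coord_basis, if_neg (rotation_ne_capCup _ _ _)]

theorem coord_cc_cc (i j k l : ℤ) :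
    coord δ (capCup i j) (cc δ k l) = if 3 ∣ i - k ∧ l - k = j - i then 1 else 0 := by
  simp only [cc, coord_basis, capCup_inj]

theorem hom_ext {M : Type*} [AddCommMonoid M] [Module ℂ M] {f g : TL 3 δ →ₗ[ℂ] M}
    (hr : ∀ n, f (rot δ n) = g (rot δ n)) (hc : ∀ i j, f (cc δ i j) = g (cc δ i j)) : f = g :=
  (basis 3 δ).ext fun α => by
    rcases α.eq_rotation_or_capCup with ⟨n, rfl⟩ | ⟨i, j, rfl⟩
    · exact hr n
    · exact hc i j

theorem ext_coord {x y : TL 3 δ} (hr : ∀ n, coord δ (rotation n) x = coord δ (rotation n) y)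
    (hc : ∀ i j, coord δ (capCup i j) x = coord δ (capCup i j) y) : x = y := by
  apply (basis 3 δ).ext_elem
  intro α
  rcases α.eq_rotation_or_capCup with ⟨n, rfl⟩ | ⟨i, j, rfl⟩
  · exact hr n
  · exact hc i j

/-- The coefficients of a Laurent polynomial. -/
noncomputable def laurentCoeff (n : ℤ) : ℂ[T;T⁻¹] →ₗ[ℂ] ℂ where
  toFun p := p.coeff n
  map_add' _ _ := rfl
  map_smul' _ _ := rfl

theorem laurentCoeff_T (m n : ℤ) : laurentCoeff m (T n) = if n = m then 1 else 0 := T_apply m n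

theorem coord_rot_rotHom (n : ℤ) (A : ℂ[T;T⁻¹]) :
    coord δ (rotation n) (rotHom δ A) = A.coeff n := by
  have : coord δ (rotation n) ∘ₗ (rotHom δ).toLinearMap = laurentCoeff n :=
    laurent_hom_ext fun m => by
      simp [rotHom_T, coord_rot_rot, laurentCoeff_T]
  exact LinearMap.congr_fun this A

theorem coord_cc_rotHom (i j : ℤ) (A : ℂ[T;T⁻¹]) :
    coord δ (capCup i j) (rotHom δ A) = 0 := by
  have : coord δ (capCup i j) ∘ₗ (rotHom δ).toLinearMap = 0 :=
    laurent_hom_ext fun m => by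
      simp [rotHom_T, coord_cc_rot]
  exact LinearMap.congr_fun this A

theorem coord_rot_ccSum_mul (n : ℤ) (A : ℂ[T;T⁻¹]) :
    coord δ (rotation n) (ccSum δ * rotHom δ A) = 0 := by
  have : coord δ (rotation n) ∘ₗ LinearMap.mulLeft ℂ (ccSum δ) ∘ₗ (rotHom δ).toLinearMap = 0 :=
    laurent_hom_ext fun m => by
      simp [rotHom_T, ccSum, add_mul, cc_mul_rot, coord_rot_cc]
  exact LinearMap.congr_fun this A

theorem coord_cc_ccSum_mul (i j : ℤ) (A : ℂ[T;T⁻¹]) :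
    coord δ (capCup i j) (ccSum δ * rotHom δ A) = A.coeff (j - i) := by
  have : coord δ (capCup i j) ∘ₗ LinearMap.mulLeft ℂ (ccSum δ) ∘ₗ (rotHom δ).toLinearMap =
      laurentCoeff (j - i) :=
    laurent_hom_ext fun m => by
      simp only [LinearMap.comp_apply, AlgHom.toLinearMap_apply, LinearMap.mulLeft_apply, rotHom_T,
        ccSum, add_mul, cc_mul_rot, map_add, coord_cc_cc, laurentCoeff_T]
      -- Exactly one of the three summands of `ccSum δ` has the residue of `i`; it contributes when
      -- `m = j - i`, and the other two never do.
      split_ifs <;> first | (exfalso; omega) | simp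
  exact LinearMap.congr_fun this A

/-- The elements euⁿ are distinct basis elements, so e A(u) determines A. -/
theorem coord_cc_mul_rotHom (n : ℤ) (A : ℂ[T;T⁻¹]) :
    coord δ (capCup 0 n) (cc δ 0 0 * rotHom δ A) = A.coeff n := by
  have : coord δ (capCup 0 n) ∘ₗ LinearMap.mulLeft ℂ (cc δ 0 0) ∘ₗ (rotHom δ).toLinearMap =
      laurentCoeff n :=
    laurent_hom_ext fun m => by
      simp [rotHom_T, cc_mul_rot, coord_cc_cc, laurentCoeff_T]
  exact LinearMap.congr_fun this A

/-- The diagram of uᵐe is `capCup (-m) 0`, which can be `capCup 0 n` only if 3 divides `m` and `n =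
m`. -/
theorem coord_rotHom_mul_cc {n : ℤ} (hn : ¬ 3 ∣ n) (A : ℂ[T;T⁻¹]) :
    coord δ (capCup 0 n) (rotHom δ A * cc δ 0 0) = 0 := by
  have : coord δ (capCup 0 n) ∘ₗ LinearMap.mulRight ℂ (cc δ 0 0) ∘ₗ (rotHom δ).toLinearMap = 0 :=
    laurent_hom_ext fun m => by
      simp only [LinearMap.comp_apply, AlgHom.toLinearMap_apply, LinearMap.mulRight_apply, rotHom_T,
        rot_mul_cc, coord_cc_cc, LinearMap.zero_apply]
      rw [if_neg (by omega)]
  exact LinearMap.congr_fun this A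

theorem coord_rot_one_mul (i j : ℤ) (z : TL 3 δ) :
    coord δ (capCup (i - 1) j) (rot δ 1 * z) = coord δ (capCup i j) z := by
  have : coord δ (capCup (i - 1) j) ∘ₗ LinearMap.mulLeft ℂ (rot δ 1) = coord δ (capCup i j) := by
    refine hom_ext (fun n => ?_) (fun k l => ?_)
    · simp [rot_mul_rot, coord_cc_rot]
    · simp only [LinearMap.comp_apply, LinearMap.mulLeft_apply, rot_mul_cc, coord_cc_cc]
      exact if_congr (by omega) rfl rfl
  exact LinearMap.congr_fun this z

theorem coord_mul_rot_one (i j : ℤ) (z : TL 3 δ) :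
    coord δ (capCup i j) (z * rot δ 1) = coord δ (capCup i (j - 1)) z := by
  have : coord δ (capCup i j) ∘ₗ LinearMap.mulRight ℂ (rot δ 1) = coord δ (capCup i (j - 1)) := by
    refine hom_ext (fun n => ?_) (fun k l => ?_)
    · simp [rot_mul_rot, coord_cc_rot]
    · simp only [LinearMap.comp_apply, LinearMap.mulRight_apply, cc_mul_rot, coord_cc_cc]
      exact if_congr (by omega) rfl rfl
  exact LinearMap.congr_fun this z

/-! ### The center -/

/-- The two terms involve disjoint sets of diagrams: A is read off at the rotations and B at the
diagrams `capCup 0 n`. -/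
theorem rotHom_add_eq_zero {A B : ℂ[T;T⁻¹]} (h : rotHom δ A + ccSum δ * rotHom δ B = 0) :
    A = 0 ∧ B = 0 := by
  constructor <;> ext n
  · have := congrArg (coord δ (rotation n)) h
    simpa [coord_rot_rotHom, coord_rot_ccSum_mul] using this
  · have := congrArg (coord δ (capCup 0 n)) h
    simpa [coord_cc_rotHom, coord_cc_ccSum_mul] using this

/-- The centralizer of the rotations. -/
theorem exists_of_comm_rot {z : TL 3 δ} (hz : rot δ 1 * z = z * rot δ 1) :
    ∃ A B : ℂ[T;T⁻¹], z = rotHom δ A + ccSum δ * rotHom δ B := by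
  -- Comparing coefficients in uz = zu shows that they are invariant under moving both indices by
  -- one, hence depend only on `j - i`.
  have hinv : ∀ i j, coord δ (capCup i j) z = coord δ (capCup (i - 1) (j - 1)) z := fun i j => by
    rw [← coord_rot_one_mul, hz, coord_mul_rot_one]
  have hzero : ∀ i j, coord δ (capCup i j) z = coord δ (capCup 0 (j - i)) z := by
    intro i
    induction i using Int.induction_on with
    | zero => intro j; rw [sub_zero]
    | succ k ih => intro j; rw [hinv, add_sub_cancel_right, ih]; congr 2; ring_nf
    | pred k ih =>
      intro j
      have := hinv (-(k : ℤ)) (j + 1)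
      rw [add_sub_cancel_right, ih] at this
      rw [← this]; congr 2; ring_nf
  have hr : Function.Injective AffineDiagram.rotation := fun _ _ h => rotation_inj.1 h
  have hc : Function.Injective (capCup 0) := fun _ _ h => by have := (capCup_inj.1 h).2; omega
  -- A collects the coefficients of z at the rotations and B those at `capCup 0 n`; injectivity of
  -- both families keeps the supports finite.
  refine ⟨.ofCoeff (((basis 3 δ).repr z).comapDomain rotation hr.injOn),
    .ofCoeff (((basis 3 δ).repr z).comapDomain (capCup 0) hc.injOn), ext_coord (fun n => ?_)
      (fun i j => ?_)⟩
  · rw [map_add, coord_rot_rotHom, coord_rot_ccSum_mul, add_zero, AddMonoidAlgebra.coeff_ofCoeff,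
      Finsupp.comapDomain_apply]
    rfl
  · rw [map_add, coord_cc_rotHom, coord_cc_ccSum_mul, zero_add, AddMonoidAlgebra.coeff_ofCoeff,
      Finsupp.comapDomain_apply, hzero]
    rfl

/-- Next to e the element f acts as q(u), so A(u) + f B(u) acts as (A + qB)(u). With `mul_cc_eq`,
commuting with e becomes a condition on this one polynomial. -/
theorem cc_mul_eq (A B : ℂ[T;T⁻¹]) : cc δ 0 0 * (rotHom δ A + ccSum δ * rotHom δ B) =
    cc δ 0 0 * rotHom δ (A + quad δ * B) := by
  rw [map_add, map_mul, mul_add, mul_add, ← mul_assoc, cc_mul_ccSum, mul_assoc]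

theorem mul_cc_eq (A B : ℂ[T;T⁻¹]) : (rotHom δ A + ccSum δ * rotHom δ B) * cc δ 0 0 =
    rotHom δ (A + quad δ * B) * cc δ 0 0 := by
  rw [mul_comm (quad δ), map_add, map_mul, add_mul, add_mul, ccSum_comm, mul_assoc, ccSum_mul_cc,
    mul_assoc]

/-- The full turn u³ commutes with e, because `capCup 0 (3n)` and `capCup (-3n) 0` have the same
lifted arcs. -/
theorem cc_comm_cubeSubst (P : ℂ[T;T⁻¹]) :
    cc δ 0 0 * rotHom δ (cubeSubst P) = rotHom δ (cubeSubst P) * cc δ 0 0 := by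
  have : LinearMap.mulLeft ℂ (cc δ 0 0) ∘ₗ (rotHom δ).toLinearMap ∘ₗ cubeSubst.toLinearMap =
      LinearMap.mulRight ℂ (cc δ 0 0) ∘ₗ (rotHom δ).toLinearMap ∘ₗ cubeSubst.toLinearMap :=
    laurent_hom_ext fun n => by
      simp only [LinearMap.comp_apply, AlgHom.toLinearMap_apply, LinearMap.mulLeft_apply,
        LinearMap.mulRight_apply, cubeSubst_T, rotHom_T, cc_mul_rot, rot_mul_cc]
      exact cc_congr (by omega) (by omega)
  exact LinearMap.congr_fun this P

theorem exists_cubeSubst {G : ℂ[T;T⁻¹]} (hG : ∀ n, ¬ 3 ∣ n → G.coeff n = 0) :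
    ∃ P, cubeSubst P = G := by
  refine ⟨.ofCoeff (G.coeff.comapDomain (fun n => 3 * n) (fun a _ b _ h => by simpa using h)), ?_⟩
  apply AddMonoidAlgebra.coeff_injective
  -- Dividing the exponents of G by 3 loses nothing, since its support consists of multiples of 3.
  refine Finsupp.mapDomain_comapDomain (fun n : ℤ => 3 * n) (fun a b h => by simpa using h) _ ?_
  intro n hn
  by_contra h
  exact (Finsupp.mem_support_iff.1 hn) (hG n fun ⟨k, hk⟩ => h ⟨k, hk.symm⟩)

theorem cubeSubst_injective : Function.Injective cubeSubst :=
  AddMonoidAlgebra.mapDomain_injective (R := ℂ) (f := fun n : ℤ => 3 * n)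
    (fun a b h => by simpa using h)

/-- `A + f B` is central if `A + (x ^ 2 + x ^ (-2) + δ) B` is a Laurent polynomial in `x ^ 3`. -/
theorem mem_center {A B P : ℂ[T;T⁻¹]} (h : A + quad δ * B = cubeSubst P) :
    rotHom δ A + ccSum δ * rotHom δ B ∈ Subalgebra.center ℂ (TL 3 δ) := by
  set z := rotHom δ A + ccSum δ * rotHom δ B with hz
  have hr : ∀ n, rot δ n * z = z * rot δ n := by
    intro n
    rw [hz, mul_add, add_mul, ← mul_assoc, ← ccSum_comm_rot, mul_assoc, mul_assoc, ← rotHom_T,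
      ← map_mul, ← map_mul, ← map_mul, ← map_mul, mul_comm, mul_comm B]
  have hc : cc δ 0 0 * z = z * cc δ 0 0 := by
    rw [hz, cc_mul_eq, mul_cc_eq, h, cc_comm_cubeSubst]
  rw [Subalgebra.mem_center_iff]
  intro b
  -- By `cc_eq`, an element commuting with all rotations and with e commutes with the whole basis.
  have : LinearMap.mulRight ℂ z = LinearMap.mulLeft ℂ z := hom_ext hr fun i j => by
    change cc δ i j * z = z * cc δ i j
    rw [cc_eq, mul_assoc, mul_assoc, hr, ← mul_assoc (cc δ 0 0), hc, mul_assoc z, ← mul_assoc,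
      hr, mul_assoc]
  exact LinearMap.congr_fun this b

theorem exists_of_mem_center {z : TL 3 δ} (hz : z ∈ Subalgebra.center ℂ (TL 3 δ)) :
    ∃ A B P : ℂ[T;T⁻¹], A + quad δ * B = cubeSubst P ∧ z = rotHom δ A + ccSum δ * rotHom δ B := by
  rw [Subalgebra.mem_center_iff] at hz
  obtain ⟨A, B, rfl⟩ := exists_of_comm_rot (hz (rot δ 1))
  have hc := hz (cc δ 0 0)
  rw [cc_mul_eq, mul_cc_eq] at hc
  -- In e C(u) = C(u) e, with C = A + qB, the coefficient at `capCup 0 n` is that of xⁿ in C on the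
  -- left and 0 on the right when 3 does not divide `n`.
  obtain ⟨P, hP⟩ := exists_cubeSubst (G := A + quad δ * B) fun n hn => by
    rw [← coord_cc_mul_rotHom (δ := δ), hc, coord_rotHom_mul_cc hn]
  exact ⟨A, B, P, hP.symm, rfl⟩

/-! ### The isomorphism with pairs of Laurent polynomials -/

theorem exists_quotient (P : laurentPairs δ) :
    ∃ B, P.1.1 + quad δ * B = cubeSubst P.1.2 := by
  obtain ⟨B, hB⟩ : quad δ ∣ P.1.1 - cubeSubst P.1.2 := P.2
  -- The sign changes because divisibility is stated for S(x) - T(x³), while B has to satisfy S + qB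
  -- = T(x³).
  exact ⟨-B, by rw [mul_neg, ← hB]; ring⟩

/-- The quotient of `T(x ^ 3) - S(x)` by `x ^ 2 + x ^ (-2) + δ`. -/
noncomputable def quotient (P : laurentPairs δ) : ℂ[T;T⁻¹] := (exists_quotient P).choose

theorem quotient_spec (P : laurentPairs δ) :
    P.1.1 + quad δ * quotient P = cubeSubst P.1.2 := (exists_quotient P).choose_spec

/-- Cancelling the nonzero q makes the chosen quotient unique, so its behaviour under sums, scalars
and products follows by checking the defining equation. -/
theorem quotient_eq {P : laurentPairs δ} {B : ℂ[T;T⁻¹]}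
    (h : P.1.1 + quad δ * B = cubeSubst P.1.2) : quotient P = B := by
  have := (quotient_spec P).trans h.symm
  exact mul_left_cancel₀ quad_ne_zero (add_left_cancel this)

/-- Everything in sight commutes, and f² = q(u) f folds the last term of the expansion back into a
multiple of f. -/
theorem rotHom_add_mul (A B A' B' : ℂ[T;T⁻¹]) :
    (rotHom δ A + ccSum δ * rotHom δ B) * (rotHom δ A' + ccSum δ * rotHom δ B') =
      rotHom δ (A * A') + ccSum δ * rotHom δ (A * B' + B * A' + quad δ * B * B') := by
  have h1 : rotHom δ A * (ccSum δ * rotHom δ B') = ccSum δ * rotHom δ (A * B') := by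
    rw [← mul_assoc, ← ccSum_comm, mul_assoc, map_mul]
  have h2 : ccSum δ * rotHom δ B * (ccSum δ * rotHom δ B') =
      ccSum δ * rotHom δ (quad δ * B * B') := by
    rw [mul_assoc, ← mul_assoc (rotHom δ B), ← ccSum_comm, ← mul_assoc, ← mul_assoc,
      ccSum_mul_self, ← ccSum_comm, map_mul, map_mul, mul_assoc, mul_assoc, mul_assoc]
  rw [add_mul, mul_add, mul_add, h1, h2, mul_assoc, ← map_mul, ← map_mul, map_add, map_add, mul_add,
    mul_add]
  abel

/-- A pair `(S, T)` as a central element. -/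
noncomputable def toCenter (δ : ℂ) : laurentPairs δ →ₐ[ℂ] Subalgebra.center ℂ (TL 3 δ) :=
  AlgHom.ofLinearMap
    { toFun := fun P => ⟨rotHom δ P.1.1 + ccSum δ * rotHom δ (quotient P),
        mem_center (quotient_spec P)⟩
      map_add' := fun P Q => by
        have : quotient (P + Q) = quotient P + quotient Q := quotient_eq (by
          have h1 := quotient_spec P
          have h2 := quotient_spec Q
          change P.1.1 + Q.1.1 + _ = cubeSubst (P.1.2 + Q.1.2)
          rw [map_add, ← h1, ← h2]; ring)
        apply Subtype.ext
        change rotHom δ (P.1.1 + Q.1.1) + ccSum δ * rotHom δ (quotient (P + Q)) =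
          (rotHom δ P.1.1 + ccSum δ * rotHom δ (quotient P)) +
            (rotHom δ Q.1.1 + ccSum δ * rotHom δ (quotient Q))
        rw [this, map_add, map_add, mul_add]
        abel
      map_smul' := fun r P => by
        have : quotient (r • P) = r • quotient P := quotient_eq (by
          change r • P.1.1 + _ = cubeSubst (r • P.1.2)
          rw [map_smul, ← quotient_spec P, smul_add, mul_smul_comm])
        apply Subtype.ext
        change rotHom δ (r • P.1.1) + ccSum δ * rotHom δ (quotient (r • P)) =
          r • (rotHom δ P.1.1 + ccSum δ * rotHom δ (quotient P))
        rw [this, map_smul, map_smul, mul_smul_comm, smul_add] }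
    (by
      have : quotient (1 : laurentPairs δ) = 0 := quotient_eq (by
        change 1 + _ = cubeSubst 1
        rw [map_one, mul_zero, add_zero])
      apply Subtype.ext
      change rotHom δ 1 + ccSum δ * rotHom δ (quotient 1) = 1
      rw [this, map_one, map_zero, mul_zero, add_zero])
    (fun P Q => by
      -- With B and B' the two quotients, (S + qB)(S' + qB') = SS' + q(SB' + BS' + qBB'), the same
      -- bracket as in `rotHom_add_mul`.
      have : quotient (P * Q) =
          P.1.1 * quotient Q + quotient P * Q.1.1 + quad δ * quotient P * quotient Q :=
        quotient_eq (by
          change P.1.1 * Q.1.1 + _ = cubeSubst (P.1.2 * Q.1.2)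
          rw [map_mul, ← quotient_spec P, ← quotient_spec Q]; ring)
      apply Subtype.ext
      change rotHom δ (P.1.1 * Q.1.1) + ccSum δ * rotHom δ (quotient (P * Q)) =
        (rotHom δ P.1.1 + ccSum δ * rotHom δ (quotient P)) *
          (rotHom δ Q.1.1 + ccSum δ * rotHom δ (quotient Q))
      rw [this, rotHom_add_mul])

theorem coe_toCenter (P : laurentPairs δ) :
    (toCenter δ P : TL 3 δ) = rotHom δ P.1.1 + ccSum δ * rotHom δ (quotient P) := rfl

/-- If S(u) + f B(u) = 0, then S = B = 0, so T(x³) = S + qB = 0 and finally T = 0. -/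
theorem toCenter_injective : Function.Injective (toCenter δ) := by
  rw [injective_iff_map_eq_zero]
  intro P hP
  obtain ⟨h1, h2⟩ := rotHom_add_eq_zero ((coe_toCenter P).symm.trans (congrArg Subtype.val hP))
  have h3 := quotient_spec P
  rw [h1, h2, mul_zero, add_zero] at h3
  exact Subtype.ext (Prod.ext h1 (cubeSubst_injective (by rw [← h3]; exact (map_zero _).symm)))

theorem toCenter_surjective : Function.Surjective (toCenter δ) := by
  rintro ⟨z, hz⟩
  obtain ⟨A, B, P, h, rfl⟩ := exists_of_mem_center hz
  have hP : (A, P) ∈ laurentPairs δ := by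
    refine ⟨-B, ?_⟩
    change A - cubeSubst P = quad δ * -B
    rw [← h]; ring
  refine ⟨⟨(A, P), hP⟩, Subtype.ext ?_⟩
  rw [coe_toCenter, quotient_eq (P := ⟨(A, P), hP⟩) h]

end TL

end AffineTL

theorem mainTheorem8 (δ : ℂ) :
    Nonempty (Subalgebra.center ℂ (AffineTL.TL 3 δ) ≃ₐ[ℂ] AffineTL.laurentPairs δ) :=
  ⟨(AlgEquiv.ofBijective (AffineTL.TL.toCenter δ)
    ⟨AffineTL.TL.toCenter_injective, AffineTL.TL.toCenter_surjective⟩).symm⟩
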